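/- Let $n\ge 1$. For a Hermitian $n\times n$ matrix $M$ and a real function $F$ defined on an interval containing the spectrum of $M$, let $F(M)$ be given by the functional calculus, so that $\operatorname{Tr}F(M)=\sum_j F(\lambda_j)$ over the eigenvalues $\lambda_j$ of $M$ with multiplicity. (0) Let $T\subseteq\mathbb R$ be an interval of positive length (for example $\mathbb R$ or $[0,1]$), and let $H=H_\tau$, $\tau\in T$, be an analytic one-parameter family of Hermitian $n\times n$ matrices with $\ddot H=0$ (for example $H_\tau=(1-\tau)A+\tau B$ with $A,B$ Hermitian). Let $J$ be an interval containing the spectra of all $H_\tau$, $\tau\in T$, and let $F$ be twice differentiable on $J$ with either $F''>0$ on $J$ or $F''<0$ on $J$ (derivatives at endpoints belonging to an interval are one-sided). Put $G=F'^2/F''$. Then $\tau\mapsto\operatorname{Tr}F(H_\tau)$ is twice differentiable on $T$ and $$\operatorname{Tr}G(H)\cdot\frac{d^2}{d\tau^2}\operatorname{Tr}F(H)\ \ge\ \Big(\frac{d}{d\tau}\operatorname{Tr}F(H)\Big)^2\qquad\text{on }T.$$ Now let $A,B$ be positive semidefinite Hermitian $n\times n$ matrices, put $H_\tau=(1-\tau)A+\tau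 B$ for $\tau\in[0,1]$, let $J$ be an interval containing the spectra of $A$ and $B$ (hence of every $H_\tau$), and let $F:J\to\mathbb R$. (1) If $F>0$ and $F$ is logarithmically convex on $J$, then $\operatorname{Tr}F(H_\tau)$ is positive and logarithmically convex on $[0,1]$, and $\operatorname{Tr}F(H_\tau)\le(\operatorname{Tr}F(A))^{1-\tau}(\operatorname{Tr}F(B))^{\tau}$ for $\tau\in[0,1]$. (2) If $F>0$ and $F^{1/p}$ is convex on $J$ for some $p\ge1$, then $(\operatorname{Tr}F(H_\tau))^{1/p}$ is convex on $[0,1]$, and $(\operatorname{Tr}F(H_\tau))^{1/p}\le(1-\tau)(\operatorname{Tr}F(A))^{1/p}+\tau(\operatorname{Tr}F(B))^{1/p}$. (3) If $F>0$ and $F^{1/p}$ is concave on $J$ for some $0<p\le1$, then $(\operatorname{Tr}F(H_\tau))^{1/p}$ is concave on $[0,1]$, and $(\operatorname{Tr}F(H_\tau))^{1/p}\ge(1-\tau)(\operatorname{Tr}F(A))^{1/p}+\tau(\operatorname{Tr}F(B))^{1/p}$. (4) If $F>0$ and $F^{-1/p}$ is concave on $J$ for some $p>0$, then $(\operatorname{Tr}F(H_\tau))^{-1/p}$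 is concave on $[0,1]$, and $(\operatorname{Tr}F(H_\tau))^{-1/p}\ge(1-\tau)(\operatorname{Tr}F(A))^{-1/p}+\tau(\operatorname{Tr}F(B))^{-1/p}$. (5) If $F$ is twice differentiable on $J$, $F''>0$ and $G=F'^2/F''\le a$ on $J$ for some $a>0$, then $\exp\!\big(-\tfrac{1}{an}\operatorname{Tr}F(H_\tau)\big)$ is concave on $[0,1]$. Moreover $\det((1-\tau)A+\tau B)^{1/n}$ is concave on $[0,1]$, and $$\det((1-\tau)A+\tau B)^{1/n}\ \ge\ (1-\tau)\det(A)^{1/n}+\tau\det(B)^{1/n}.$$ -/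

import Mathlib

open scoped ComplexOrder

/-- `Tr F(M)` for a Hermitian matrix `M`: the trace of `F(M)`, formed with the functional calculus
`cfc`, so that it is the sum of `F` over the eigenvalues of `M` with multiplicity. (`F(M)` is
Hermitian, so its trace is real; the real part only moves it from `ℂ` to `ℝ`.) -/
noncomputable def traceFun {n : ℕ} (F : ℝ → ℝ) (M : Matrix (Fin n) (Fin n) ℂ) : ℝ :=
  (Matrix.trace (cfc F M)).re

theorem traceFun_eq_sum {n : ℕ} (F : ℝ → ℝ) {M : Matrix (Fin n) (Fin n) ℂ}
    (hM : M.IsHermitian) : traceFun F M = ∑ i, F (hM.eigenvalues i) := by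
  rw [traceFun, hM.cfc_eq, Matrix.IsHermitian.cfc, Unitary.conjStarAlgAut_apply,
    Matrix.trace_mul_comm, ← mul_assoc]
  simp [Matrix.trace_diagonal]

/-- The first derivative of `F` on the interval `J` (one-sided at endpoints belonging to `J`). -/
noncomputable def firstDeriv (F : ℝ → ℝ) (J : Set ℝ) : ℝ → ℝ := derivWithin F J

/-- The second derivative of `F` on the interval `J` (one-sided at endpoints belonging to `J`). -/
noncomputable def secondDeriv (F : ℝ → ℝ) (J : Set ℝ) : ℝ → ℝ :=
  derivWithin (derivWithin F J) J

/-- `F` is twice differentiable on the interval `J`; the second derivative need not be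
continuous. -/
def TwiceDifferentiableOn (F : ℝ → ℝ) (J : Set ℝ) : Prop :=
  DifferentiableOn ℝ F J ∧ DifferentiableOn ℝ (derivWithin F J) J

/-- The function `G = F'² / F''` on `J`. -/
noncomputable def quotG (F : ℝ → ℝ) (J : Set ℝ) (x : ℝ) : ℝ :=
  (firstDeriv F J x) ^ 2 / secondDeriv F J x

/-- `g` is positive and logarithmically convex on `S`. -/
def LogConvexOn (S : Set ℝ) (g : ℝ → ℝ) : Prop :=
  (∀ x ∈ S, 0 < g x) ∧ ConvexOn ℝ S (fun x => Real.log (g x))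

/-- `H = H_τ` is, on the interval `T`, an analytic one-parameter family of Hermitian matrices
with vanishing second derivative; both conditions are read entrywise. -/
def IsAffineHermitianFamily {n : ℕ} (H : ℝ → Matrix (Fin n) (Fin n) ℂ) (T : Set ℝ) : Prop :=
  (∀ τ ∈ T, (H τ).IsHermitian) ∧
  (∀ i j, AnalyticOn ℝ (fun τ => H τ i j) T) ∧
  (∀ i j, ∀ τ ∈ T, derivWithin (derivWithin (fun s => H s i j) T) T τ = 0)

/-- `(1 - τ) A + τ B`. -/
noncomputable def mixture {n : ℕ} (A B : Matrix (Fin n) (Fin n) ℂ) (τ : ℝ) :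
    Matrix (Fin n) (Fin n) ℂ :=
  (1 - τ) • A + τ • B

/-! Fix `τ`, diagonalise `H τ` by a unitary `U` with eigenvalues `λ_i`, and let `b = U* Ḣ U`.
Perturbation theory gives `(Tr F)' = ∑ F'(λ_i) b_ii` and `(Tr F)'' = ∑ F'[λ_i, λ_j] |b_ij|²`, where
`F'[x, y]` is the divided difference of `F'`. If `F'' > 0`, every summand is nonnegative, so the
second derivative is at least `∑ F''(λ_i) b_ii²`, and Cauchy-Schwarz with `F'² = G F''` gives the
differential inequality; `F'' < 0` follows by changing the sign of `F`. Since `F''` need not be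
continuous, the derivative formula (`hasDerivWithinAt_trace_cfc_mul`) is proved for polynomials and
carried over to `F'` by Hermite interpolation on the spectrum of `H τ`.

The differential inequality yields (5). Statements (1)-(4) assume no differentiability and use
another route. In an eigenbasis of the mixture, its eigenvalues are mixtures of the diagonal entries
of `A` and `B`. The scalar hypothesis on `F` applies entry by entry, Hölder's or Minkowski's
inequality sums the result, and Peierls' inequality (`sum_convex_diag_le`) replaces the sums of `F`
over diagonals by traces. The determinant bound has the same shape, with superadditivity of the
geometric mean as the vector inequality and Hadamard's inequality in place of Peierls'. -/

section

open Matrix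

/-! ### Unitary matrices, diagonals in orthonormal bases, and Peierls' inequality. -/

theorem sum_norm_sq_col_of_unitary {n : ℕ} {U : Matrix (Fin n) (Fin n) ℂ}
    (hU : U ∈ Matrix.unitaryGroup (Fin n) ℂ) (j : Fin n) : ∑ i, ‖U i j‖ ^ 2 = 1 := by
  have h := congrFun (congrFun (Matrix.mem_unitaryGroup_iff'.mp hU) j) j
  rw [Matrix.mul_apply] at h
  simp only [Matrix.star_apply, Matrix.one_apply_eq, RCLike.star_def, RCLike.conj_mul] at h
  apply Complex.ofReal_injective
  simpa using h

theorem sum_norm_sq_row_of_unitary {n : ℕ} {U : Matrix (Fin n) (Fin n) ℂ}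
    (hU : U ∈ Matrix.unitaryGroup (Fin n) ℂ) (i : Fin n) : ∑ j, ‖U i j‖ ^ 2 = 1 := by
  simpa [Matrix.star_apply] using sum_norm_sq_col_of_unitary (Unitary.star_mem hU) i

theorem norm_mul_mul_apply_le_of_unitary {n : ℕ} {U V : Matrix (Fin n) (Fin n) ℂ}
    (hU : U ∈ Matrix.unitaryGroup (Fin n) ℂ) (hV : V ∈ Matrix.unitaryGroup (Fin n) ℂ)
    (K : Matrix (Fin n) (Fin n) ℂ) (i j : Fin n) :
    ‖(star U * K * V) i j‖ ≤ ∑ l, ∑ k, ‖K k l‖ := by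
  rw [Matrix.mul_apply]
  refine (norm_sum_le _ _).trans (Finset.sum_le_sum fun l _ => ?_)
  rw [norm_mul, Matrix.mul_apply]
  refine (mul_le_of_le_one_right (norm_nonneg _) (entry_norm_bound_of_unitary hV _ _)).trans ?_
  refine (norm_sum_le _ _).trans (Finset.sum_le_sum fun k _ => ?_)
  rw [norm_mul]
  exact mul_le_of_le_one_left (norm_nonneg _)
    (entry_norm_bound_of_unitary (Unitary.star_mem hU) _ _)

namespace Matrix.IsHermitian

variable {n : ℕ} {A : Matrix (Fin n) (Fin n) ℂ}

theorem star_eigenvectorUnitary_mul_mul (hA : A.IsHermitian) :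
    star (hA.eigenvectorUnitary : Matrix (Fin n) (Fin n) ℂ) * A * hA.eigenvectorUnitary =
      diagonal (fun i => (hA.eigenvalues i : ℂ)) := by
  have h := hA.conjStarAlgAut_star_eigenvectorUnitary
  rwa [Unitary.conjStarAlgAut_star_apply] at h

theorem eq_eigenvectorUnitary_mul_mul (hA : A.IsHermitian) :
    A = (hA.eigenvectorUnitary : Matrix (Fin n) (Fin n) ℂ) *
      diagonal (fun i => (hA.eigenvalues i : ℂ)) *
        star (hA.eigenvectorUnitary : Matrix (Fin n) (Fin n) ℂ) := by
  have h := hA.spectral_theorem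
  rwa [Unitary.conjStarAlgAut_apply] at h

theorem trace_cfc_mul (hA : A.IsHermitian) (f : ℝ → ℝ) (K : Matrix (Fin n) (Fin n) ℂ) :
    (trace (cfc f A * K)).re = ∑ j, f (hA.eigenvalues j) *
      ((star (hA.eigenvectorUnitary : Matrix (Fin n) (Fin n) ℂ) * K *
        hA.eigenvectorUnitary) j j).re := by
  rw [hA.cfc_eq, Matrix.IsHermitian.cfc, Unitary.conjStarAlgAut_apply, mul_assoc, mul_assoc,
    Matrix.trace_mul_comm, mul_assoc, mul_assoc, trace, Complex.re_sum]
  refine Finset.sum_congr rfl fun j _ => ?_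
  rw [diag_apply, diagonal_mul]
  simp

/-- The diagonal of `U* A U` is a doubly stochastic average of the eigenvalues of `A`. -/
theorem exists_doublyStochastic_diag (hA : A.IsHermitian) {U : Matrix (Fin n) (Fin n) ℂ}
    (hU : U ∈ unitaryGroup (Fin n) ℂ) :
    ∃ w : Fin n → Fin n → ℝ, (∀ k i, 0 ≤ w k i) ∧ (∀ i, ∑ k, w k i = 1) ∧
      (∀ k, ∑ i, w k i = 1) ∧
      ∀ i, ((star U * A * U) i i).re = ∑ k, w k i * hA.eigenvalues k := by
  set V : Matrix (Fin n) (Fin n) ℂ := hA.eigenvectorUnitary.1 with hV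
  have hW : star V * U ∈ unitaryGroup (Fin n) ℂ :=
    mul_mem (Unitary.star_mem hA.eigenvectorUnitary.2) hU
  refine ⟨fun k i => ‖(star V * U) k i‖ ^ 2, fun _ _ => by positivity,
    sum_norm_sq_col_of_unitary hW, sum_norm_sq_row_of_unitary hW, fun i => ?_⟩
  have h : star U * A * U =
      star (star V * U) * (diagonal (fun i => (hA.eigenvalues i : ℂ)) * (star V * U)) := by
    conv_lhs => rw [hA.eq_eigenvectorUnitary_mul_mul]
    simp only [star_mul, star_star, mul_assoc, hV]
  rw [h, mul_apply, Complex.re_sum]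
  refine Finset.sum_congr rfl fun k _ => ?_
  rw [diagonal_mul, star_apply, mul_left_comm, RCLike.star_def, RCLike.conj_mul, mul_comm]
  simp [← Complex.ofReal_pow]

theorem re_diag_mem {J : Set ℝ} (hJ : Convex ℝ J) (hA : A.IsHermitian)
    (hs : spectrum ℝ A ⊆ J) {U : Matrix (Fin n) (Fin n) ℂ} (hU : U ∈ unitaryGroup (Fin n) ℂ)
    (i : Fin n) : ((star U * A * U) i i).re ∈ J := by
  obtain ⟨w, h0, h1, -, h⟩ := hA.exists_doublyStochastic_diag hU
  rw [h]
  exact hJ.sum_mem (fun k _ => h0 k i) (h1 i) fun k _ => hs (hA.eigenvalues_mem_spectrum_real k)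

/-- **Peierls' inequality** for convex functions. -/
theorem sum_convex_diag_le {J : Set ℝ} {F : ℝ → ℝ} (hF : ConvexOn ℝ J F) (hA : A.IsHermitian)
    (hs : spectrum ℝ A ⊆ J) {U : Matrix (Fin n) (Fin n) ℂ} (hU : U ∈ unitaryGroup (Fin n) ℂ) :
    ∑ i, F ((star U * A * U) i i).re ≤ traceFun F A := by
  obtain ⟨w, h0, h1, h2, h⟩ := hA.exists_doublyStochastic_diag hU
  calc ∑ i, F ((star U * A * U) i i).re ≤ ∑ i, ∑ k, w k i * F (hA.eigenvalues k) := by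
        refine Finset.sum_le_sum fun i _ => ?_
        rw [h]
        exact hF.map_sum_le (fun k _ => h0 k i) (h1 i)
          fun k _ => hs (hA.eigenvalues_mem_spectrum_real k)
    _ = traceFun F A := by
        rw [Finset.sum_comm, traceFun_eq_sum F hA]
        simp [← Finset.sum_mul, h2]

theorem traceFun_neg (hA : A.IsHermitian) (F : ℝ → ℝ) :
    traceFun (fun x => -F x) A = -traceFun F A := by
  simp [traceFun_eq_sum _ hA]

/-- **Peierls' inequality** for concave functions. -/
theorem le_sum_concave_diag {J : Set ℝ} {F : ℝ → ℝ} (hF : ConcaveOn ℝ J F) (hA : A.IsHermitian)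
    (hs : spectrum ℝ A ⊆ J) {U : Matrix (Fin n) (Fin n) ℂ} (hU : U ∈ unitaryGroup (Fin n) ℂ) :
    traceFun F A ≤ ∑ i, F ((star U * A * U) i i).re := by
  have h := hA.sum_convex_diag_le hF.neg hs hU
  have h' := hA.traceFun_neg F
  simp only [Pi.neg_apply, Finset.sum_neg_distrib] at h
  change _ ≤ traceFun (fun x => -F x) A at h
  linarith

/-- A crude substitute for Weyl's perturbation bound, with no ordering of eigenvalues. With `W = U*
V` for the two eigenvector matrices, the `(i, j)` entry of `U* (B - A) V` is the eigenvalue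
difference times `W i j`, and `i` can be chosen so that this entry of `W` is not small. -/
theorem exists_eigenvalue_near {B : Matrix (Fin n) (Fin n) ℂ} (hA : A.IsHermitian)
    (hB : B.IsHermitian) (j : Fin n) :
    ∃ i, |hB.eigenvalues j - hA.eigenvalues i| ≤ n * ∑ l, ∑ k, ‖(B - A) k l‖ := by
  set U : Matrix (Fin n) (Fin n) ℂ := hA.eigenvectorUnitary.1 with hU
  set V : Matrix (Fin n) (Fin n) ℂ := hB.eigenvectorUnitary.1 with hV
  have hUm : U ∈ unitaryGroup (Fin n) ℂ := hA.eigenvectorUnitary.2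
  have hVm : V ∈ unitaryGroup (Fin n) ℂ := hB.eigenvectorUnitary.2
  have hW : star U * V ∈ unitaryGroup (Fin n) ℂ := mul_mem (Unitary.star_mem hUm) hVm
  have hn : 0 < (n : ℝ) := by exact_mod_cast j.pos
  have hUU : U * star U = 1 := mem_unitaryGroup_iff.mp hUm
  have hVV : V * star V = 1 := mem_unitaryGroup_iff.mp hVm
  -- Column `j` of a unitary matrix has `n` squared moduli with sum `1`, so one of them is at least
  -- `1 / n`.
  obtain ⟨i, hi⟩ : ∃ i, (1 : ℝ) / n ≤ ‖(star U * V) i j‖ ^ 2 := by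
    by_contra! h
    have : ∑ i, ‖(star U * V) i j‖ ^ 2 < ∑ _i : Fin n, (1 : ℝ) / n :=
      Finset.sum_lt_sum_of_nonempty ⟨j, Finset.mem_univ j⟩ fun i _ => h i
    rw [sum_norm_sq_col_of_unitary hW] at this
    simp [hn.ne'] at this
  refine ⟨i, ?_⟩
  -- The modulus is at most `1`, hence at least its own square.
  have hi' : (1 : ℝ) / n ≤ ‖(star U * V) i j‖ := by
    have h1 := entry_norm_bound_of_unitary hW i j
    have h0 := norm_nonneg ((star U * V) i j)
    nlinarith
  have key : star U * (B - A) * V = (star U * V) * diagonal (fun i => (hB.eigenvalues i : ℂ)) -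
      diagonal (fun i => (hA.eigenvalues i : ℂ)) * (star U * V) := by
    rw [← hA.star_eigenvectorUnitary_mul_mul, ← hB.star_eigenvectorUnitary_mul_mul, ← hU, ← hV]
    have e1 : star U * V * (star V * B * V) = star U * ((V * star V) * B) * V := by
      simp only [mul_assoc]
    have e2 : star U * A * U * (star U * V) = star U * (A * (U * star U)) * V := by
      simp only [mul_assoc]
    rw [e1, e2, hUU, hVV, one_mul, mul_one, mul_sub, sub_mul]
  have key' := congrFun (congrFun key i) j
  rw [sub_apply, mul_diagonal, diagonal_mul] at key'
  have hb := norm_mul_mul_apply_le_of_unitary hUm hVm (B - A) i j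
  rw [key', mul_comm ((star U * V) i j), ← sub_mul, norm_mul, ← Complex.ofReal_sub,
    Complex.norm_real, Real.norm_eq_abs] at hb
  have h3 : |hB.eigenvalues j - hA.eigenvalues i| * (1 / n) ≤ ∑ l, ∑ k, ‖(B - A) k l‖ :=
    (mul_le_mul_of_nonneg_left hi' (abs_nonneg _)).trans hb
  rwa [mul_one_div, div_le_iff₀' hn] at h3

end Matrix.IsHermitian

/-! ### Divided differences and the derivative of `Tr (f(H) K)`. -/

/-- Hermite interpolation: the nodal polynomial `N` has simple zeros at the nodes, so adding `N * M`
to the Lagrange interpolant keeps the values and shifts the derivative at a node `x` by `N'(x)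
M(x)`, where `N'(x) ≠ 0`. -/
theorem Polynomial.exists_eval_eq_and_derivative_eval_eq {R : Type*} [Field R] [DecidableEq R]
    (s : Finset R) (f f' : R → R) :
    ∃ p : Polynomial R, ∀ x ∈ s, p.eval x = f x ∧ p.derivative.eval x = f' x := by
  set L := Lagrange.interpolate s id f with hL
  set N := Lagrange.nodal s (id : R → R) with hN
  set M := Lagrange.interpolate s id
    (fun x => (f' x - L.derivative.eval x) / N.derivative.eval x) with hM
  refine ⟨L + N * M, fun x hx => ?_⟩
  have h1 : L.eval x = f x := Lagrange.eval_interpolate_at_node f Function.injective_id.injOn hx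
  have h2 : N.eval x = 0 := Lagrange.eval_nodal_at_node (v := id) hx
  have h3 : M.eval x = (f' x - L.derivative.eval x) / N.derivative.eval x :=
    Lagrange.eval_interpolate_at_node (v := id) _ Function.injective_id.injOn hx
  have h4 : N.derivative.eval x ≠ 0 := by
    have h := Lagrange.eval_nodal_derivative_eval_node_eq (v := (id : R → R)) hx
    simp only [id] at h
    rw [hN, h]
    exact Lagrange.eval_nodal_not_at_node fun i hi => (Finset.ne_of_mem_erase hi).symm
  constructor
  · simp [h1, h2]
  · simp [h2, h3, Polynomial.derivative_mul, mul_div_cancel₀ _ h4]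

/-- The divided difference of `f`, with the value `f' x` on the diagonal. -/
noncomputable def divDiff (f f' : ℝ → ℝ) (x y : ℝ) : ℝ :=
  if x = y then f' x else (f x - f y) / (x - y)

theorem divDiff_self (f f' : ℝ → ℝ) (x : ℝ) : divDiff f f' x x = f' x := if_pos rfl

/-- The Leibniz rule `(fg)[x, y] = f[x, y] g(y) + f(x) g[x, y]` with `g` the identity. It matches
the product rule for `Y ^ k * Y` at a diagonal matrix. -/
theorem divDiff_pow_succ (k : ℕ) (x y : ℝ) :
    divDiff (fun x => x ^ (k + 1)) (fun x => (k + 1 : ℕ) * x ^ k) x y =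
      divDiff (fun x => x ^ k) (fun x => k * x ^ (k - 1)) x y * y + x ^ k := by
  unfold divDiff
  split_ifs with h
  · subst h
    rcases k with _ | k
    · simp
    · push_cast
      ring
  · have : x - y ≠ 0 := sub_ne_zero.mpr h
    field_simp
    ring

theorem hasDerivWithinAt_pow_apply {n : ℕ} {Y : ℝ → Matrix (Fin n) (Fin n) ℂ}
    {B : Matrix (Fin n) (Fin n) ℂ} {T : Set ℝ} {τ : ℝ} {l : Fin n → ℝ}
    (hY : ∀ i j, HasDerivWithinAt (fun s => Y s i j) (B i j) T τ)
    (hd : Y τ = diagonal (fun i => (l i : ℂ))) (k : ℕ) (i j : Fin n) :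
    HasDerivWithinAt (fun s => (Y s ^ k) i j)
      ((divDiff (fun x => x ^ k) (fun x => k * x ^ (k - 1)) (l i) (l j) : ℝ) * B i j) T τ := by
  induction k generalizing i j with
  | zero =>
    have : divDiff (fun x => x ^ 0) (fun x => (0 : ℕ) * x ^ (0 - 1)) (l i) (l j) = 0 := by
      simp [divDiff]
    rw [this]
    simpa using hasDerivWithinAt_const τ T ((1 : Matrix (Fin n) (Fin n) ℂ) i j)
  | succ k ih =>
    have h := HasDerivWithinAt.fun_sum fun (m : Fin n) (_ : m ∈ Finset.univ) =>
      (ih i m).mul (hY m j)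
    simp only [Pi.mul_apply, Finset.sum_add_distrib, hd, diagonal_pow, Pi.pow_def] at h
    simp only [Nat.add_sub_cancel, pow_succ, mul_apply]
    simp only [← pow_succ]
    refine h.congr_deriv ?_
    rw [divDiff_pow_succ]
    simp only [diagonal_apply, mul_ite, mul_zero, ite_mul, zero_mul, Finset.sum_ite_eq,
      Finset.sum_ite_eq', Finset.mem_univ, if_true]
    push_cast
    ring

theorem hasDerivWithinAt_aeval_apply {n : ℕ} {Y : ℝ → Matrix (Fin n) (Fin n) ℂ}
    {B : Matrix (Fin n) (Fin n) ℂ} {T : Set ℝ} {τ : ℝ} {l : Fin n → ℝ}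
    (hY : ∀ i j, HasDerivWithinAt (fun s => Y s i j) (B i j) T τ)
    (hd : Y τ = diagonal (fun i => (l i : ℂ))) (p : Polynomial ℝ) (i j : Fin n) :
    HasDerivWithinAt (fun s => (Polynomial.aeval (Y s) p) i j)
      ((divDiff (fun x => p.eval x) (fun x => p.derivative.eval x) (l i) (l j) : ℝ) * B i j)
      T τ := by
  induction p using Polynomial.induction_on' with
  | add p q hp hq =>
    simp only [map_add, Matrix.add_apply]
    refine (hp.add hq).congr_deriv ?_
    rw [← add_mul, ← Complex.ofReal_add]
    congr 2
    unfold divDiff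
    split_ifs
    · simp
    · simp only [Polynomial.eval_add]
      ring
  | monomial k a =>
    simp only [Polynomial.aeval_monomial, Algebra.algebraMap_eq_smul_one, smul_mul_assoc, one_mul,
      Matrix.smul_apply]
    refine ((hasDerivWithinAt_pow_apply hY hd k i j).const_smul a).congr_deriv ?_
    rw [Complex.real_smul, ← mul_assoc, ← Complex.ofReal_mul]
    congr 2
    unfold divDiff
    split_ifs
    · simp [Polynomial.derivative_monomial, mul_assoc]
    · simp only [Polynomial.eval_monomial]
      ring

theorem hasDerivWithinAt_mul_mul_apply {n : ℕ} {H : ℝ → Matrix (Fin n) (Fin n) ℂ}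
    {B : Matrix (Fin n) (Fin n) ℂ} {T : Set ℝ} {τ : ℝ}
    (hH : ∀ i j, HasDerivWithinAt (fun s => H s i j) (B i j) T τ)
    (U V : Matrix (Fin n) (Fin n) ℂ) (i j : Fin n) :
    HasDerivWithinAt (fun s => (U * H s * V) i j) ((U * B * V) i j) T τ := by
  simp only [mul_apply]
  exact HasDerivWithinAt.fun_sum fun m _ => (HasDerivWithinAt.fun_sum fun k _ =>
    (hH k m).const_mul (U i k)).mul_const (V m j)

/-- The eigenvector matrix of `H τ` is held fixed while `s` varies. Conjugating by it preserves the
trace and makes the family diagonal at `s = τ`, where the entrywise formula applies; no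
differentiable choice of eigenvectors is involved. -/
theorem hasDerivWithinAt_trace_aeval_mul {n : ℕ} {H : ℝ → Matrix (Fin n) (Fin n) ℂ}
    {B K : Matrix (Fin n) (Fin n) ℂ} {T : Set ℝ} {τ : ℝ}
    (hH : ∀ i j, HasDerivWithinAt (fun s => H s i j) (B i j) T τ) (h0 : (H τ).IsHermitian)
    (p : Polynomial ℝ) :
    HasDerivWithinAt (fun s => (trace (Polynomial.aeval (H s) p * K)).re)
      (∑ i, ∑ j, divDiff (fun x => p.eval x) (fun x => p.derivative.eval x)
        (h0.eigenvalues i) (h0.eigenvalues j) *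
        ((star h0.eigenvectorUnitary.1 * B * h0.eigenvectorUnitary.1) i j *
          (star h0.eigenvectorUnitary.1 * K * h0.eigenvectorUnitary.1) j i).re) T τ := by
  set U := h0.eigenvectorUnitary with hU
  have hUU : U.1 * star U.1 = 1 := mem_unitaryGroup_iff.mp U.2
  have hconj : ∀ s, trace (Polynomial.aeval (H s) p * K) =
      trace (Polynomial.aeval (star U.1 * H s * U.1) p * (star U.1 * K * U.1)) := fun s => by
    have h := Polynomial.aeval_algHom_apply (Unitary.conjStarAlgAut ℝ _ (star U)) (H s) p
    rw [Unitary.conjStarAlgAut_star_apply, Unitary.conjStarAlgAut_star_apply] at h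
    rw [h]
    have e : star U.1 * (Polynomial.aeval (H s)) p * U.1 * (star U.1 * K * U.1) =
        star U.1 * ((Polynomial.aeval (H s)) p * (U.1 * star U.1) * K * U.1) := by
      simp only [mul_assoc]
    rw [e, hUU, mul_one, trace_mul_comm (star U.1), mul_assoc _ U.1, hUU, mul_one]
  simp only [hconj]
  have hY := hasDerivWithinAt_aeval_apply
    (hasDerivWithinAt_mul_mul_apply hH (star U.1) U.1) h0.star_eigenvectorUnitary_mul_mul p
  have h1 := HasDerivWithinAt.fun_sum fun (i : Fin n) (_ : i ∈ Finset.univ) =>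
    HasDerivWithinAt.fun_sum fun (j : Fin n) (_ : j ∈ Finset.univ) =>
      (hY i j).mul_const ((star U.1 * K * U.1) j i)
  have h2 := Complex.reCLM.hasFDerivAt.comp_hasDerivWithinAt τ h1
  simp only [trace, diag_apply, mul_apply (M := Polynomial.aeval _ p)]
  refine h2.congr_deriv ?_
  simp [mul_assoc]

/-- The eigenvalues of `H s` lie within `O(|s - τ|)` of those of `H τ`, where `g` vanishes to first
order, so `g` is `o(|s - τ|)` on the spectrum of `H s`. The weights from `K` are bounded uniformly
over all unitary matrices, so the eigenvectors of `H s` may vary discontinuously. -/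
theorem hasDerivWithinAt_trace_cfc_mul_zero {n : ℕ} {H : ℝ → Matrix (Fin n) (Fin n) ℂ}
    {B K : Matrix (Fin n) (Fin n) ℂ} {T J : Set ℝ} {τ : ℝ} (hτ : τ ∈ T)
    (hH : ∀ i j, HasDerivWithinAt (fun s => H s i j) (B i j) T τ)
    (hherm : ∀ s ∈ T, (H s).IsHermitian) (hs : ∀ s ∈ T, spectrum ℝ (H s) ⊆ J) {g : ℝ → ℝ}
    (hg : ∀ x ∈ spectrum ℝ (H τ), g x = 0 ∧ HasDerivWithinAt g 0 J x) :
    HasDerivWithinAt (fun s => (trace (cfc g (H s) * K)).re) 0 T τ := by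
  have h0 := hherm τ hτ
  set N : ℝ → ℝ := fun s => n * ∑ l, ∑ k, ‖(H s - H τ) k l‖ with hN
  set M : ℝ := ∑ l, ∑ k, ‖K k l‖ with hM
  have hM0 : 0 ≤ M := Finset.sum_nonneg fun _ _ => Finset.sum_nonneg fun _ _ => norm_nonneg _
  have hN0 : ∀ s, 0 ≤ N s := fun s => mul_nonneg (Nat.cast_nonneg _)
    (Finset.sum_nonneg fun _ _ => Finset.sum_nonneg fun _ _ => norm_nonneg _)
  have hNO : N =O[nhdsWithin τ T] fun s => s - τ :=
    (Asymptotics.IsBigO.fun_sum fun l _ => Asymptotics.IsBigO.fun_sum fun k _ =>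
      ((hH k l).hasFDerivWithinAt.isBigO_sub).norm_left).const_mul_left _
  have hNt : Filter.Tendsto N (nhdsWithin τ T) (nhds 0) := by
    refine hNO.trans_tendsto ?_
    have : Filter.Tendsto (fun s : ℝ => s - τ) (nhds τ) (nhds (τ - τ)) :=
      (continuous_id.sub continuous_const).tendsto τ
    rw [sub_self] at this
    exact this.mono_left nhdsWithin_le_nhds
  have hval : (trace (cfc g (H τ) * K)).re = 0 := by
    rw [h0.trace_cfc_mul]
    exact Finset.sum_eq_zero fun j _ => by
      rw [(hg _ (h0.eigenvalues_mem_spectrum_real j)).1, zero_mul]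
  rw [hasDerivWithinAt_iff_isLittleO]
  simp only [hval, sub_zero, smul_zero]
  refine Asymptotics.IsLittleO.trans_isBigO (g := N) ?_ hNO
  refine Asymptotics.isLittleO_iff.mpr fun c hc => ?_
  -- The final sum has `n` terms, each with a weight at most `M`; the added `1` keeps the
  -- denominator positive when `n * M = 0`.
  have hε : 0 < c / (n * M + 1) := by positivity
  have hloc : ∀ i, ∃ δ > 0, ∀ x ∈ J, |x - h0.eigenvalues i| < δ →
      |g x| ≤ c / (n * M + 1) * |x - h0.eigenvalues i| := fun i => by
    obtain ⟨hz, hd⟩ := hg _ (h0.eigenvalues_mem_spectrum_real i)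
    rw [hasDerivWithinAt_iff_isLittleO] at hd
    have := Asymptotics.isLittleO_iff.mp hd hε
    rw [eventually_nhdsWithin_iff, Metric.eventually_nhds_iff] at this
    obtain ⟨δ, hδ, h⟩ := this
    exact ⟨δ, hδ, fun x hx hxd => by simpa [hz] using h hxd hx⟩
  choose δ hδ hb using hloc
  have hev : ∀ᶠ s in nhdsWithin τ T, ∀ i, N s < δ i :=
    Filter.eventually_all.mpr fun i => hNt.eventually (gt_mem_nhds (hδ i))
  filter_upwards [hev, self_mem_nhdsWithin] with s hsδ hsT
  have hsH := hherm s hsT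
  rw [hsH.trace_cfc_mul, Real.norm_eq_abs, Real.norm_eq_abs, abs_of_nonneg (hN0 s)]
  have hterm : ∀ j, |g (hsH.eigenvalues j) * ((star hsH.eigenvectorUnitary.1 * K *
      hsH.eigenvectorUnitary.1) j j).re| ≤ c / (n * M + 1) * N s * M := fun j => by
    rw [abs_mul]
    obtain ⟨i, hi⟩ := h0.exists_eigenvalue_near hsH j
    refine mul_le_mul ((hb i _ (hs s hsT (hsH.eigenvalues_mem_spectrum_real j))
      (hi.trans_lt (hsδ i))).trans (mul_le_mul_of_nonneg_left hi hε.le)) ?_ (abs_nonneg _)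
      (mul_nonneg hε.le (hN0 s))
    exact (Complex.abs_re_le_norm _).trans (norm_mul_mul_apply_le_of_unitary
      hsH.eigenvectorUnitary.2 hsH.eigenvectorUnitary.2 K j j)
  refine (Finset.abs_sum_le_sum_abs _ _).trans ((Finset.sum_le_sum fun j _ => hterm j).trans ?_)
  rw [Finset.sum_const, Finset.card_univ, Fintype.card_fin, nsmul_eq_mul]
  have hp : (0 : ℝ) < n * M + 1 := by positivity
  have e : n * (c / (n * M + 1) * N s * M) = (n * M / (n * M + 1)) * (c * N s) := by
    field_simp
  rw [e]
  exact mul_le_of_le_one_left (mul_nonneg hc.le (hN0 s)) ((div_le_one hp).mpr (by linarith))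

/-- Daleckii-Krein formula for the trace of `f(H) K`, for a merely differentiable `f`. -/
theorem hasDerivWithinAt_trace_cfc_mul {n : ℕ} {H : ℝ → Matrix (Fin n) (Fin n) ℂ}
    {B K : Matrix (Fin n) (Fin n) ℂ} {T J : Set ℝ} {τ : ℝ} (hτ : τ ∈ T)
    (hH : ∀ i j, HasDerivWithinAt (fun s => H s i j) (B i j) T τ)
    (hherm : ∀ s ∈ T, (H s).IsHermitian) (hs : ∀ s ∈ T, spectrum ℝ (H s) ⊆ J) {f f' : ℝ → ℝ}
    (hf : ∀ x ∈ J, HasDerivWithinAt f (f' x) J x) :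
    HasDerivWithinAt (fun s => (trace (cfc f (H s) * K)).re)
      (∑ i, ∑ j, divDiff f f' ((hherm τ hτ).eigenvalues i) ((hherm τ hτ).eigenvalues j) *
        ((star (hherm τ hτ).eigenvectorUnitary.1 * B * (hherm τ hτ).eigenvectorUnitary.1) i j *
          (star (hherm τ hτ).eigenvectorUnitary.1 * K * (hherm τ hτ).eigenvectorUnitary.1) j i).re)
      T τ := by
  set h0 := hherm τ hτ
  -- Since `p` agrees with `f` to first order on the spectrum of `H τ`, the remainder `f - p`
  -- contributes derivative zero, and `p` has the same divided differences there as `f`.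
  obtain ⟨p, hp⟩ := Polynomial.exists_eval_eq_and_derivative_eval_eq
    (Finset.univ.image h0.eigenvalues) f f'
  have hp' : ∀ i, p.eval (h0.eigenvalues i) = f (h0.eigenvalues i) ∧
      p.derivative.eval (h0.eigenvalues i) = f' (h0.eigenvalues i) :=
    fun i => hp _ (Finset.mem_image_of_mem _ (Finset.mem_univ i))
  have hpoly := hasDerivWithinAt_trace_aeval_mul (K := K) hH h0 p
  have hrem := hasDerivWithinAt_trace_cfc_mul_zero (K := K) (g := fun x => f x - p.eval x)
    hτ hH hherm hs fun x hx => by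
      have hx' := hx
      rw [h0.spectrum_real_eq_range_eigenvalues] at hx
      obtain ⟨i, rfl⟩ := hx
      refine ⟨by rw [(hp' i).1, sub_self], ?_⟩
      have := (hf _ (hs τ hτ hx')).sub (p.hasDerivAt (h0.eigenvalues i)).hasDerivWithinAt
      rwa [(hp' i).2, sub_self] at this
  have hsum : ∀ s ∈ T, (trace (cfc f (H s) * K)).re =
      (trace (Polynomial.aeval (H s) p * K)).re +
        (trace (cfc (fun x => f x - p.eval x) (H s) * K)).re := fun s hsT => by
    rw [← cfc_polynomial p (H s) (hherm s hsT).isSelfAdjoint, (hherm s hsT).trace_cfc_mul,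
      (hherm s hsT).trace_cfc_mul, (hherm s hsT).trace_cfc_mul, ← Finset.sum_add_distrib]
    exact Finset.sum_congr rfl fun j _ => by ring
  refine ((hpoly.add hrem).congr hsum (hsum τ hτ)).congr_deriv ?_
  rw [add_zero]
  refine Finset.sum_congr rfl fun i _ => Finset.sum_congr rfl fun j _ => ?_
  simp only [divDiff, (hp' i).1, (hp' j).1, (hp' i).2]

/-! ### First and second derivatives of `Tr F` along an affine family. -/

theorem Set.OrdConnected.uniqueDiffOn_of_nontrivial {T : Set ℝ} (hT : T.OrdConnected)
    (hT' : T.Nontrivial) : UniqueDiffOn ℝ T :=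
  uniqueDiffOn_convex hT.convex (hT.convex.nontrivial_iff_nonempty_interior.mp hT')

/-- A vanishing second derivative on an interval makes the entrywise derivative constant.
Differentiating the conjugated entries and using uniqueness of derivatives shows that this constant
matrix is Hermitian. -/
theorem IsAffineHermitianFamily.exists_hasDerivWithinAt {n : ℕ}
    {H : ℝ → Matrix (Fin n) (Fin n) ℂ} {T : Set ℝ} (hT : T.OrdConnected) (hT' : T.Nontrivial)
    (hH : IsAffineHermitianFamily H T) :
    ∃ B : Matrix (Fin n) (Fin n) ℂ, B.IsHermitian ∧
      ∀ τ ∈ T, ∀ i j, HasDerivWithinAt (fun s => H s i j) (B i j) T τ := by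
  have hu := hT.uniqueDiffOn_of_nontrivial hT'
  obtain ⟨t, ht⟩ := hT'.nonempty
  obtain ⟨hherm, han, hzero⟩ := hH
  have hd : ∀ τ ∈ T, ∀ i j, HasDerivWithinAt (fun s => H s i j)
      (derivWithin (fun s => H s i j) T t) T τ := fun τ hτ i j => by
    have hdd : DifferentiableOn ℝ (derivWithin (fun s => H s i j) T) T :=
      (ContDiffOn.derivWithin (m := 1) ((han i j).contDiffOn (n := 2) hu) hu
        (by norm_num)).differentiableOn one_ne_zero
    have hc : derivWithin (fun s => H s i j) T t = derivWithin (fun s => H s i j) T τ := by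
      refine hT.convex.is_const_of_fderivWithin_eq_zero (𝕜 := ℝ) hdd (fun x hx => ?_) ht hτ
      have h := (hdd x hx).hasDerivWithinAt
      rw [hzero i j x hx] at h
      have h' := h.hasFDerivWithinAt.fderivWithin (hu x hx)
      simpa using h'
    rw [hc]
    exact ((han i j).differentiableOn τ hτ).hasDerivWithinAt
  refine ⟨of fun i j => derivWithin (fun s => H s i j) T t, ?_, fun τ hτ i j => hd τ hτ i j⟩
  ext i j
  rw [conjTranspose_apply, of_apply, of_apply]
  have h := ((hd t ht j i).star).congr (f₁ := fun s => H s i j)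
    (fun s hs => ((hherm s hs).apply i j).symm) ((hherm t ht).apply i j).symm
  exact ((hu t ht).eq_deriv _ (hd t ht i j) h).symm

section Family

variable {n : ℕ} {H : ℝ → Matrix (Fin n) (Fin n) ℂ} {B : Matrix (Fin n) (Fin n) ℂ}
  {T J : Set ℝ} {F : ℝ → ℝ}

/-- The case `K = 1`: conjugation leaves the identity, so only the diagonal divided differences, the
values of `F'`, survive. -/
theorem hasDerivWithinAt_traceFun (hherm : ∀ s ∈ T, (H s).IsHermitian)
    (hH : ∀ τ ∈ T, ∀ i j, HasDerivWithinAt (fun s => H s i j) (B i j) T τ)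
    (hs : ∀ s ∈ T, spectrum ℝ (H s) ⊆ J) (hF : DifferentiableOn ℝ F J) {τ : ℝ} (hτ : τ ∈ T) :
    HasDerivWithinAt (fun s => traceFun F (H s)) (trace (cfc (firstDeriv F J) (H τ) * B)).re
      T τ := by
  have h := hasDerivWithinAt_trace_cfc_mul (K := 1) hτ (hH τ hτ) hherm hs
    (f := F) (f' := firstDeriv F J) fun x hx => (hF x hx).hasDerivWithinAt
  simp only [mul_one] at h
  refine h.congr_deriv ?_
  rw [(hherm τ hτ).trace_cfc_mul]
  refine Finset.sum_congr rfl fun i _ => ?_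
  rw [mem_unitaryGroup_iff'.mp (hherm τ hτ).eigenvectorUnitary.2,
    Finset.sum_eq_single i (fun j _ hj => by simp [one_apply_ne hj]) (by simp), divDiff_self,
    one_apply_eq, mul_one]

/-- The case `K = B`: the conjugate of `B` is Hermitian, so its `(i, j)` and `(j, i)` entries
multiply to a squared modulus. -/
theorem hasDerivWithinAt_trace_firstDeriv (hB : B.IsHermitian)
    (hherm : ∀ s ∈ T, (H s).IsHermitian)
    (hH : ∀ τ ∈ T, ∀ i j, HasDerivWithinAt (fun s => H s i j) (B i j) T τ)
    (hs : ∀ s ∈ T, spectrum ℝ (H s) ⊆ J) (hF : TwiceDifferentiableOn F J) {τ : ℝ} (hτ : τ ∈ T) :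
    HasDerivWithinAt (fun s => (trace (cfc (firstDeriv F J) (H s) * B)).re)
      (∑ i, ∑ j, divDiff (firstDeriv F J) (secondDeriv F J) ((hherm τ hτ).eigenvalues i)
        ((hherm τ hτ).eigenvalues j) * ‖(star (hherm τ hτ).eigenvectorUnitary.1 * B *
          (hherm τ hτ).eigenvectorUnitary.1) i j‖ ^ 2) T τ := by
  refine (hasDerivWithinAt_trace_cfc_mul (K := B) hτ (hH τ hτ) hherm hs
    (f := firstDeriv F J) (f' := secondDeriv F J)
    fun x hx => (hF.2 x hx).hasDerivWithinAt).congr_deriv ?_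
  refine Finset.sum_congr rfl fun i _ => Finset.sum_congr rfl fun j _ => ?_
  have h := (isHermitian_conjTranspose_mul_mul (hherm τ hτ).eigenvectorUnitary.1 hB).apply j i
  rw [← star_eq_conjTranspose] at h
  rw [← h, RCLike.star_def, RCLike.mul_conj]
  simp [← Complex.ofReal_pow]

theorem firstDeriv_traceFun (hu : UniqueDiffOn ℝ T) (hherm : ∀ s ∈ T, (H s).IsHermitian)
    (hH : ∀ τ ∈ T, ∀ i j, HasDerivWithinAt (fun s => H s i j) (B i j) T τ)
    (hs : ∀ s ∈ T, spectrum ℝ (H s) ⊆ J) (hF : DifferentiableOn ℝ F J) {τ : ℝ} (hτ : τ ∈ T) :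
    firstDeriv (fun s => traceFun F (H s)) T τ = (trace (cfc (firstDeriv F J) (H τ) * B)).re :=
  (hasDerivWithinAt_traceFun hherm hH hs hF hτ).derivWithin (hu τ hτ)

theorem hasDerivWithinAt_firstDeriv_traceFun (hu : UniqueDiffOn ℝ T) (hB : B.IsHermitian)
    (hherm : ∀ s ∈ T, (H s).IsHermitian)
    (hH : ∀ τ ∈ T, ∀ i j, HasDerivWithinAt (fun s => H s i j) (B i j) T τ)
    (hs : ∀ s ∈ T, spectrum ℝ (H s) ⊆ J) (hF : TwiceDifferentiableOn F J) {τ : ℝ} (hτ : τ ∈ T) :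
    HasDerivWithinAt (firstDeriv (fun s => traceFun F (H s)) T)
      (∑ i, ∑ j, divDiff (firstDeriv F J) (secondDeriv F J) ((hherm τ hτ).eigenvalues i)
        ((hherm τ hτ).eigenvalues j) * ‖(star (hherm τ hτ).eigenvectorUnitary.1 * B *
          (hherm τ hτ).eigenvectorUnitary.1) i j‖ ^ 2) T τ :=
  (hasDerivWithinAt_trace_firstDeriv hB hherm hH hs hF hτ).congr
    (fun _ hs' => firstDeriv_traceFun hu hherm hH hs hF.1 hs')
    (firstDeriv_traceFun hu hherm hH hs hF.1 hτ)

end Family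

/-! ### The differential inequality. -/

theorem divDiff_nonneg_of_monotoneOn {J : Set ℝ} {f f' : ℝ → ℝ} (hf : MonotoneOn f J)
    (hf' : ∀ x ∈ J, 0 ≤ f' x) {x y : ℝ} (hx : x ∈ J) (hy : y ∈ J) : 0 ≤ divDiff f f' x y := by
  unfold divDiff
  split_ifs with h
  · exact hf' x hx
  · rcases le_total x y with hxy | hxy
    · exact div_nonneg_of_nonpos (sub_nonpos.mpr (hf hx hy hxy)) (sub_nonpos.mpr hxy)
    · exact div_nonneg (sub_nonneg.mpr (hf hy hx hxy)) (sub_nonneg.mpr hxy)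

theorem monotoneOn_firstDeriv {J : Set ℝ} {F : ℝ → ℝ} (hJ : J.OrdConnected)
    (hF : TwiceDifferentiableOn F J) (h2 : ∀ x ∈ J, 0 < secondDeriv F J x) :
    MonotoneOn (firstDeriv F J) J :=
  monotoneOn_of_hasDerivWithinAt_nonneg hJ.convex hF.2.continuousOn
    (fun x hx => ((hF.2 x (interior_subset hx)).hasDerivWithinAt).mono interior_subset)
    fun x hx => (h2 x (interior_subset hx)).le

section Inequality

variable {n : ℕ} {H : ℝ → Matrix (Fin n) (Fin n) ℂ} {T J : Set ℝ} {F : ℝ → ℝ}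

theorem twiceDifferentiableOn_traceFun (hT : T.OrdConnected) (hT' : T.Nontrivial)
    (hH : IsAffineHermitianFamily H T) (hs : ∀ τ ∈ T, spectrum ℝ (H τ) ⊆ J)
    (hF : TwiceDifferentiableOn F J) :
    TwiceDifferentiableOn (fun τ => traceFun F (H τ)) T := by
  obtain ⟨B, hB, hd⟩ := hH.exists_hasDerivWithinAt hT hT'
  exact ⟨fun τ hτ => (hasDerivWithinAt_traceFun hH.1 hd hs hF.1 hτ).differentiableWithinAt,
    fun τ hτ => (hasDerivWithinAt_firstDeriv_traceFun (hT.uniqueDiffOn_of_nontrivial hT') hB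
      hH.1 hd hs hF hτ).differentiableWithinAt⟩

/-- Cauchy-Schwarz over the eigenvalue index `i`, pairing `G(λ_i)` with the `i`-th row sum of the
second derivative. Monotonicity of `F'` makes all divided differences nonnegative. The separate
bound `0 ≤` lets `Tr G` be replaced by a larger constant later. -/
theorem traceFun_secondDeriv_inequality (hT : T.OrdConnected) (hT' : T.Nontrivial)
    (hJ : J.OrdConnected) (hH : IsAffineHermitianFamily H T)
    (hs : ∀ τ ∈ T, spectrum ℝ (H τ) ⊆ J) (hF : TwiceDifferentiableOn F J)
    (h2 : ∀ x ∈ J, 0 < secondDeriv F J x) {τ : ℝ} (hτ : τ ∈ T) :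
    0 ≤ secondDeriv (fun s => traceFun F (H s)) T τ ∧
      (firstDeriv (fun s => traceFun F (H s)) T τ) ^ 2 ≤
        traceFun (quotG F J) (H τ) * secondDeriv (fun s => traceFun F (H s)) T τ := by
  obtain ⟨B, hB, hd⟩ := hH.exists_hasDerivWithinAt hT hT'
  have hu := hT.uniqueDiffOn_of_nontrivial hT'
  have h0 := hH.1 τ hτ
  have e2 : secondDeriv (fun s => traceFun F (H s)) T τ = _ :=
    (hasDerivWithinAt_firstDeriv_traceFun hu hB hH.1 hd hs hF hτ).derivWithin (hu τ hτ)
  have hmem : ∀ i, h0.eigenvalues i ∈ J := fun i => hs τ hτ (h0.eigenvalues_mem_spectrum_real i)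
  have hterm : ∀ i j, 0 ≤ divDiff (firstDeriv F J) (secondDeriv F J) (h0.eigenvalues i)
      (h0.eigenvalues j) * ‖(star h0.eigenvectorUnitary.1 * B *
        h0.eigenvectorUnitary.1) i j‖ ^ 2 := fun i j =>
    mul_nonneg (divDiff_nonneg_of_monotoneOn (monotoneOn_firstDeriv hJ hF h2)
      (fun x hx => (h2 x hx).le) (hmem i) (hmem j)) (sq_nonneg _)
  rw [e2, firstDeriv_traceFun hu hH.1 hd hs hF.1 hτ, h0.trace_cfc_mul, traceFun_eq_sum _ h0]
  refine ⟨Finset.sum_nonneg fun i _ => Finset.sum_nonneg fun j _ => hterm i j,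
    Finset.sum_sq_le_sum_mul_sum_of_sq_le_mul _
      (fun i _ => div_nonneg (sq_nonneg _) (h2 _ (hmem i)).le)
      (fun i _ => Finset.sum_nonneg fun j _ => hterm i j) fun i _ => ?_⟩
  -- Of the `i`-th row only the diagonal term is kept: it carries `F''(λ_i)`, which cancels the
  -- denominator of `G`.
  refine le_trans ?_ (mul_le_mul_of_nonneg_left
    (Finset.single_le_sum (fun j _ => hterm i j) (Finset.mem_univ i))
    (div_nonneg (sq_nonneg _) (h2 _ (hmem i)).le))
  rw [quotG, divDiff_self, mul_pow, ← mul_assoc, div_mul_cancel₀ _ (h2 _ (hmem i)).ne']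
  refine mul_le_mul_of_nonneg_left ?_ (sq_nonneg _)
  exact sq_le_sq' (neg_le_of_abs_le (Complex.abs_re_le_norm _)) (Complex.re_le_norm _)

theorem firstDeriv_neg (F : ℝ → ℝ) (J : Set ℝ) :
    firstDeriv (fun x => -F x) J = fun x => -firstDeriv F J x :=
  funext fun _ => derivWithin.fun_neg

theorem secondDeriv_neg (F : ℝ → ℝ) (J : Set ℝ) :
    secondDeriv (fun x => -F x) J = fun x => -secondDeriv F J x := by
  funext x
  change derivWithin (firstDeriv (fun x => -F x) J) J x = _
  rw [firstDeriv_neg]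
  exact derivWithin.fun_neg

theorem TwiceDifferentiableOn.neg (hF : TwiceDifferentiableOn F J) :
    TwiceDifferentiableOn (fun x => -F x) J := by
  refine ⟨hF.1.neg, ?_⟩
  change DifferentiableOn ℝ (firstDeriv (fun x => -F x) J) J
  rw [firstDeriv_neg]
  exact hF.2.neg

/-- Replacing `F` by `-F` changes the sign of both `G` and the second derivative of the trace, so
their product is unchanged. -/
theorem sq_firstDeriv_traceFun_le (hT : T.OrdConnected) (hT' : T.Nontrivial)
    (hJ : J.OrdConnected) (hH : IsAffineHermitianFamily H T)
    (hs : ∀ τ ∈ T, spectrum ℝ (H τ) ⊆ J) (hF : TwiceDifferentiableOn F J)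
    (h2 : (∀ x ∈ J, 0 < secondDeriv F J x) ∨ (∀ x ∈ J, secondDeriv F J x < 0))
    {τ : ℝ} (hτ : τ ∈ T) :
    (firstDeriv (fun s => traceFun F (H s)) T τ) ^ 2 ≤
      traceFun (quotG F J) (H τ) * secondDeriv (fun s => traceFun F (H s)) T τ := by
  rcases h2 with h2 | h2
  · exact (traceFun_secondDeriv_inequality hT hT' hJ hH hs hF h2 hτ).2
  · have h := (traceFun_secondDeriv_inequality hT hT' hJ hH hs hF.neg
      (fun x hx => by rw [secondDeriv_neg]; exact neg_pos.mpr (h2 x hx)) hτ).2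
    have eG : quotG (fun x => -F x) J = fun x => -quotG F J x := by
      funext x
      simp only [quotG, firstDeriv_neg, secondDeriv_neg, neg_sq, div_neg]
    have e : (fun s => traceFun (fun x => -F x) (H s)) = fun s => -traceFun F (H s) := by
      funext s
      simp only [traceFun, cfc_neg, trace_neg, Complex.neg_re]
    rw [e, firstDeriv_neg, secondDeriv_neg, eG, (hH.1 τ hτ).traceFun_neg] at h
    simpa using h

end Inequality

/-! ### Scalar and vector inequalities for power and geometric means. -/

theorem weighted_add_pos {τ u v : ℝ} (hτ : τ ∈ Set.Icc (0 : ℝ) 1) (hu : 0 < u) (hv : 0 < v) :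
    0 < (1 - τ) * u + τ * v :=
  (convex_Ioi (0 : ℝ)) hu hv (sub_nonneg.mpr hτ.2) hτ.1 (sub_add_cancel 1 τ)

theorem geom_mean_le_weighted_add {τ u v : ℝ} (hτ : τ ∈ Set.Icc (0 : ℝ) 1) (hu : 0 ≤ u)
    (hv : 0 ≤ v) : u ^ (1 - τ) * v ^ τ ≤ (1 - τ) * u + τ * v :=
  Real.geom_mean_le_arith_mean2_weighted (sub_nonneg.mpr hτ.2) hτ.1 hu hv (sub_add_cancel 1 τ)

/-- The weighted power mean of exponent `1 / r`. -/
noncomputable def powerMean (r τ s t : ℝ) : ℝ := ((1 - τ) * s ^ (1 / r) + τ * t ^ (1 / r)) ^ r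

theorem powerMean_pos {r τ s t : ℝ} (hτ : τ ∈ Set.Icc (0 : ℝ) 1) (hs : 0 < s) (ht : 0 < t) :
    0 < powerMean r τ s t :=
  Real.rpow_pos_of_pos
    (weighted_add_pos hτ (Real.rpow_pos_of_pos hs _) (Real.rpow_pos_of_pos ht _)) _

theorem powerMean_rpow {r τ s t : ℝ} (hr : r ≠ 0) (hτ : τ ∈ Set.Icc (0 : ℝ) 1) (hs : 0 < s)
    (ht : 0 < t) : powerMean r τ s t ^ (1 / r) = (1 - τ) * s ^ (1 / r) + τ * t ^ (1 / r) := by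
  rw [powerMean, ← Real.rpow_mul (weighted_add_pos hτ (Real.rpow_pos_of_pos hs _)
    (Real.rpow_pos_of_pos ht _)).le, mul_one_div_cancel hr, Real.rpow_one]

theorem powerMean_mono {r τ s t s' t' : ℝ} (hτ : τ ∈ Set.Icc (0 : ℝ) 1) (hs : 0 < s) (ht : 0 < t)
    (hss : s ≤ s') (htt : t ≤ t') : powerMean r τ s t ≤ powerMean r τ s' t' := by
  have hτ0 := hτ.1
  have hτ1 : 0 ≤ 1 - τ := sub_nonneg.mpr hτ.2
  have hpos := weighted_add_pos hτ (Real.rpow_pos_of_pos hs (1 / r))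
    (Real.rpow_pos_of_pos ht (1 / r))
  have hpos' := weighted_add_pos hτ (Real.rpow_pos_of_pos (hs.trans_le hss) (1 / r))
    (Real.rpow_pos_of_pos (ht.trans_le htt) (1 / r))
  unfold powerMean
  rcases le_total 0 r with hr | hr
  · have h : 0 ≤ 1 / r := one_div_nonneg.mpr hr
    gcongr
  · have h : 1 / r ≤ 0 := one_div_nonpos.mpr hr
    refine Real.rpow_le_rpow_of_nonpos hpos' ?_ hr
    have h1 := Real.rpow_le_rpow_of_nonpos hs hss h
    have h2 := Real.rpow_le_rpow_of_nonpos ht htt h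
    gcongr

theorem rpow_one_div_rpow {r s : ℝ} (hr : r ≠ 0) (hs : 0 < s) : (s ^ (1 / r)) ^ r = s := by
  rw [← Real.rpow_mul hs.le, one_div_mul_cancel hr, Real.rpow_one]

/-- For `σ = 1` and `σ = -1` this is a comparison of a power mean with the arithmetic mean in either
direction. -/
theorem mul_powerMean_le {σ r τ s t : ℝ} (hr : r ≠ 0)
    (hc : ConvexOn ℝ (Set.Ioi 0) fun x : ℝ => σ * x ^ r) (hτ : τ ∈ Set.Icc (0 : ℝ) 1)
    (hs : 0 < s) (ht : 0 < t) : σ * powerMean r τ s t ≤ (1 - τ) * (σ * s) + τ * (σ * t) := by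
  have h := hc.2 (Real.rpow_pos_of_pos hs (1 / r)) (Real.rpow_pos_of_pos ht (1 / r))
    (sub_nonneg.mpr hτ.2) hτ.1 (sub_add_cancel 1 τ)
  simpa only [powerMean, smul_eq_mul, rpow_one_div_rpow hr hs, rpow_one_div_rpow hr ht] using h

/-- Minkowski's inequality (`σ = 1`) and its reverse (`σ = -1`), for positive vectors. -/
theorem mul_sum_powerMean_le {ι : Type*} [Fintype ι] [Nonempty ι] {σ r τ : ℝ} (hr : r ≠ 0)
    (hc : ConvexOn ℝ (Set.Ioi 0) fun x : ℝ => σ * x ^ r) (hτ : τ ∈ Set.Icc (0 : ℝ) 1)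
    {x y : ι → ℝ} (hx : ∀ i, 0 < x i) (hy : ∀ i, 0 < y i) :
    σ * ∑ i, powerMean r τ (x i) (y i) ≤ σ * powerMean r τ (∑ i, x i) (∑ i, y i) := by
  have hSx : 0 < ∑ i, x i := Finset.sum_pos (fun i _ => hx i) Finset.univ_nonempty
  have hSy : 0 < ∑ i, y i := Finset.sum_pos (fun i _ => hy i) Finset.univ_nonempty
  set X := (∑ i, x i) ^ (1 / r) with hX
  set Y := (∑ i, y i) ^ (1 / r) with hY
  have hX0 : 0 < X := Real.rpow_pos_of_pos hSx _
  have hY0 : 0 < Y := Real.rpow_pos_of_pos hSy _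
  set Z := (1 - τ) * X + τ * Y with hZ
  have hZ0 : 0 < Z := weighted_add_pos hτ hX0 hY0
  have hτ1 : 0 ≤ 1 - τ := sub_nonneg.mpr hτ.2
  -- These weights turn the mixture of the vectors of `1 / r`-th powers, divided by `Z`, into a
  -- convex combination of the normalised vectors with entries `x i ^ (1 / r) / X` and `y i ^ (1 /
  -- r) / Y`. The `r`-th powers of each normalised vector sum to `1`.
  have hα : 0 ≤ (1 - τ) * X / Z := div_nonneg (mul_nonneg hτ1 hX0.le) hZ0.le
  have hβ : 0 ≤ τ * Y / Z := div_nonneg (mul_nonneg hτ.1 hY0.le) hZ0.le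
  have hαβ : (1 - τ) * X / Z + τ * Y / Z = 1 := by rw [← add_div, ← hZ, div_self hZ0.ne']
  have hterm : ∀ i, σ * powerMean r τ (x i) (y i) ≤ σ * Z ^ r *
      ((1 - τ) * X / Z * (x i / ∑ i, x i) + τ * Y / Z * (y i / ∑ i, y i)) := fun i => by
    have hu := Real.rpow_pos_of_pos (hx i) (1 / r)
    have hv := Real.rpow_pos_of_pos (hy i) (1 / r)
    have h := hc.2 (div_pos hu hX0) (div_pos hv hY0) hα hβ hαβ
    simp only [smul_eq_mul] at h
    rw [Real.div_rpow hu.le hX0.le, Real.div_rpow hv.le hY0.le, rpow_one_div_rpow hr (hx i),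
      rpow_one_div_rpow hr (hy i), hX, hY, rpow_one_div_rpow hr hSx, rpow_one_div_rpow hr hSy,
      ← hX, ← hY] at h
    have e : (1 - τ) * X / Z * (x i ^ (1 / r) / X) + τ * Y / Z * (y i ^ (1 / r) / Y) =
        ((1 - τ) * x i ^ (1 / r) + τ * y i ^ (1 / r)) / Z := by
      field_simp
    rw [e, Real.div_rpow (weighted_add_pos hτ hu hv).le hZ0.le] at h
    have hZr : 0 < Z ^ r := Real.rpow_pos_of_pos hZ0 _
    have h' := mul_le_mul_of_nonneg_left h hZr.le
    have e1 : Z ^ r * (σ * (((1 - τ) * x i ^ (1 / r) + τ * y i ^ (1 / r)) ^ r / Z ^ r)) =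
        σ * powerMean r τ (x i) (y i) := by
      rw [powerMean]
      field_simp
    rw [e1] at h'
    refine h'.trans_eq ?_
    ring
  calc σ * ∑ i, powerMean r τ (x i) (y i) = ∑ i, σ * powerMean r τ (x i) (y i) :=
        Finset.mul_sum _ _ _
    _ ≤ ∑ i, σ * Z ^ r *
      ((1 - τ) * X / Z * (x i / ∑ i, x i) + τ * Y / Z * (y i / ∑ i, y i)) :=
        Finset.sum_le_sum fun i _ => hterm i
    _ = σ * Z ^ r := by
        rw [← Finset.mul_sum, Finset.sum_add_distrib, ← Finset.mul_sum, ← Finset.mul_sum,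
          ← Finset.sum_div, ← Finset.sum_div, div_self hSx.ne', div_self hSy.ne', mul_one, mul_one,
          hαβ, mul_one]

/-- Two uses of weighted AM-GM: on `x, y` inside the order-reversing power, then on `x ^ r, y ^ r`.
-/
theorem convexOn_rpow_of_nonpos {r : ℝ} (hr : r ≤ 0) :
    ConvexOn ℝ (Set.Ioi 0) fun x : ℝ => x ^ r := by
  refine ⟨convex_Ioi 0, fun x (hx : 0 < x) y (hy : 0 < y) a b ha hb hab => ?_⟩
  have hp : 0 < x ^ a * y ^ b := mul_pos (Real.rpow_pos_of_pos hx _) (Real.rpow_pos_of_pos hy _)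
  refine (Real.rpow_le_rpow_of_nonpos hp
    (Real.geom_mean_le_arith_mean2_weighted ha hb hx.le hy.le hab) hr).trans ?_
  rw [Real.mul_rpow (Real.rpow_pos_of_pos hx _).le (Real.rpow_pos_of_pos hy _).le,
    ← Real.rpow_mul hx.le, ← Real.rpow_mul hy.le, mul_comm a, mul_comm b, Real.rpow_mul hx.le,
    Real.rpow_mul hy.le]
  exact Real.geom_mean_le_arith_mean2_weighted ha hb (Real.rpow_pos_of_pos hx _).le
    (Real.rpow_pos_of_pos hy _).le hab

/-- **Hölder's inequality** for positive vectors with weights `1 - τ` and `τ`. -/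
theorem sum_rpow_mul_rpow_le {ι : Type*} [Fintype ι] [Nonempty ι] {τ : ℝ}
    (hτ : τ ∈ Set.Icc (0 : ℝ) 1) {x y : ι → ℝ} (hx : ∀ i, 0 < x i) (hy : ∀ i, 0 < y i) :
    ∑ i, x i ^ (1 - τ) * y i ^ τ ≤ (∑ i, x i) ^ (1 - τ) * (∑ i, y i) ^ τ := by
  have hX : 0 < ∑ i, x i := Finset.sum_pos (fun i _ => hx i) Finset.univ_nonempty
  have hY : 0 < ∑ i, y i := Finset.sum_pos (fun i _ => hy i) Finset.univ_nonempty
  have hP : 0 < (∑ i, x i) ^ (1 - τ) * (∑ i, y i) ^ τ :=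
    mul_pos (Real.rpow_pos_of_pos hX _) (Real.rpow_pos_of_pos hY _)
  rw [← div_le_one hP, Finset.sum_div]
  calc ∑ i, x i ^ (1 - τ) * y i ^ τ / ((∑ i, x i) ^ (1 - τ) * (∑ i, y i) ^ τ)
      ≤ ∑ i, ((1 - τ) * (x i / ∑ i, x i) + τ * (y i / ∑ i, y i)) := by
        refine Finset.sum_le_sum fun i _ => ?_
        rw [mul_div_mul_comm, ← Real.div_rpow (hx i).le hX.le, ← Real.div_rpow (hy i).le hY.le]
        exact geom_mean_le_weighted_add hτ (div_pos (hx i) hX).le (div_pos (hy i) hY).le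
    _ = 1 := by
        rw [Finset.sum_add_distrib, ← Finset.mul_sum, ← Finset.mul_sum, ← Finset.sum_div,
          ← Finset.sum_div, div_self hX.ne', div_self hY.ne']
        ring

/-- The geometric mean is superadditive. -/
theorem geom_mean_add_le {ι : Type*} [Fintype ι] [Nonempty ι] {x y : ι → ℝ} (hx : ∀ i, 0 ≤ x i)
    (hy : ∀ i, 0 ≤ y i) :
    (∏ i, x i) ^ (1 / (Fintype.card ι : ℝ)) + (∏ i, y i) ^ (1 / (Fintype.card ι : ℝ)) ≤
      (∏ i, (x i + y i)) ^ (1 / (Fintype.card ι : ℝ)) := by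
  set c : ℝ := 1 / (Fintype.card ι : ℝ) with hc
  have hn : (0 : ℝ) < Fintype.card ι := by exact_mod_cast Fintype.card_pos
  have hc0 : 0 < c := one_div_pos.mpr hn
  have hzn : ∀ i, 0 ≤ x i + y i := fun i => add_nonneg (hx i) (hy i)
  -- The main argument divides by `x i + y i`; if one of these sums vanishes, all three products are
  -- zero.
  by_cases hz : ∃ i, x i + y i = 0
  · obtain ⟨i, hi⟩ := hz
    have hxi : x i = 0 := le_antisymm (by linarith [hy i]) (hx i)
    have hyi : y i = 0 := le_antisymm (by linarith [hx i]) (hy i)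
    rw [Finset.prod_eq_zero (Finset.mem_univ i) hxi, Finset.prod_eq_zero (Finset.mem_univ i) hyi,
      Finset.prod_eq_zero (Finset.mem_univ i) hi, Real.zero_rpow hc0.ne', add_zero]
  · push Not at hz
    have hzp : ∀ i, 0 < x i + y i := fun i => (hzn i).lt_of_ne' (hz i)
    have hZ : 0 < ∏ i, (x i + y i) := Finset.prod_pos fun i _ => hzp i
    -- AM-GM for the ratios `u i / (x i + y i)`, used for `u = x` and `u = y`; the two arithmetic
    -- means add up to `1`.
    have amgm : ∀ u : ι → ℝ, (∀ i, 0 ≤ u i) → (∏ i, u i) ^ c ≤ (∏ i, (x i + y i)) ^ c *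
        ∑ i, c * (u i / (x i + y i)) := fun u hu => by
      have h := Real.geom_mean_le_arith_mean_weighted Finset.univ (fun _ => c)
        (fun i => u i / (x i + y i)) (fun _ _ => hc0.le)
        (by rw [Finset.sum_const, Finset.card_univ, nsmul_eq_mul, hc, mul_one_div_cancel hn.ne'])
        (fun i _ => div_nonneg (hu i) (hzn i))
      rw [Real.finsetProd_rpow _ _ fun i _ => div_nonneg (hu i) (hzn i), Finset.prod_div_distrib,
        Real.div_rpow (Finset.prod_nonneg fun i _ => hu i) hZ.le,
        div_le_iff₀' (Real.rpow_pos_of_pos hZ _)] at h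
      exact h
    refine (add_le_add (amgm x hx) (amgm y hy)).trans_eq ?_
    rw [← mul_add, ← Finset.sum_add_distrib]
    have : ∀ i, c * (x i / (x i + y i)) + c * (y i / (x i + y i)) = c := fun i => by
      rw [← mul_add, ← add_div, div_self (hz i), mul_one]
    rw [Finset.sum_congr rfl fun i _ => this i, Finset.sum_const, Finset.card_univ, nsmul_eq_mul,
      hc, mul_one_div_cancel hn.ne', mul_one]

/-! ### Trace inequalities along the segment from `A` to `B`. -/

section Mixture

variable {n : ℕ} {A B : Matrix (Fin n) (Fin n) ℂ} {J : Set ℝ} {F : ℝ → ℝ}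

theorem mixture_mixture (A B : Matrix (Fin n) (Fin n) ℂ) (s t τ : ℝ) :
    mixture (mixture A B s) (mixture A B t) τ = mixture A B ((1 - τ) * s + τ * t) := by
  unfold mixture
  module

theorem mixture_apply (A B : Matrix (Fin n) (Fin n) ℂ) (τ : ℝ) (i j : Fin n) :
    mixture A B τ i j = A i j + τ • (B i j - A i j) := by
  simp only [mixture, Matrix.add_apply, Matrix.smul_apply]
  module

theorem isHermitian_mixture (hA : A.IsHermitian) (hB : B.IsHermitian) (τ : ℝ) :
    (mixture A B τ).IsHermitian := by
  ext i j
  rw [conjTranspose_apply, mixture_apply, mixture_apply, star_add, star_smul, star_sub, hA.apply,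
    hB.apply, star_trivial]

theorem re_diag_mixture (A B U : Matrix (Fin n) (Fin n) ℂ) (τ : ℝ) (i : Fin n) :
    ((star U * mixture A B τ * U) i i).re =
      (1 - τ) * ((star U * A * U) i i).re + τ * ((star U * B * U) i i).re := by
  simp [mixture, mul_add, add_mul]

/-- The eigenvalues of a mixture are mixtures of diagonal entries in an eigenbasis. -/
theorem exists_eigenvalues_mixture (hA : A.IsHermitian) (hB : B.IsHermitian) (τ : ℝ) :
    ∃ U ∈ unitaryGroup (Fin n) ℂ, ∀ i, (isHermitian_mixture hA hB τ).eigenvalues i =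
      (1 - τ) * ((star U * A * U) i i).re + τ * ((star U * B * U) i i).re := by
  set h := isHermitian_mixture hA hB τ
  refine ⟨h.eigenvectorUnitary.1, h.eigenvectorUnitary.2, fun i => ?_⟩
  rw [← re_diag_mixture, h.star_eigenvectorUnitary_mul_mul, diagonal_apply_eq, Complex.ofReal_re]

theorem spectrum_mixture_subset (hJ : J.OrdConnected) (hA : A.IsHermitian) (hB : B.IsHermitian)
    (hAJ : spectrum ℝ A ⊆ J) (hBJ : spectrum ℝ B ⊆ J) {τ : ℝ} (hτ : τ ∈ Set.Icc (0 : ℝ) 1) :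
    spectrum ℝ (mixture A B τ) ⊆ J := by
  obtain ⟨U, hU, h⟩ := exists_eigenvalues_mixture hA hB τ
  rw [(isHermitian_mixture hA hB τ).spectrum_real_eq_range_eigenvalues]
  rintro _ ⟨i, rfl⟩
  rw [h]
  exact hJ.convex (hA.re_diag_mem hJ.convex hAJ hU i) (hB.re_diag_mem hJ.convex hBJ hU i)
    (sub_nonneg.mpr hτ.2) hτ.1 (sub_add_cancel 1 τ)

theorem posSemidef_mixture (hA : A.PosSemidef) (hB : B.PosSemidef) {τ : ℝ}
    (hτ : τ ∈ Set.Icc (0 : ℝ) 1) : (mixture A B τ).PosSemidef :=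
  (hA.smul (sub_nonneg.mpr hτ.2)).add (hB.smul hτ.1)

/-- A mixture of two points of the segment is again a point of the segment, so an inequality stated
for the endpoints of arbitrary subsegments is already concavity. -/
theorem concaveOn_mixture {g : Matrix (Fin n) (Fin n) ℂ → ℝ}
    (h : ∀ s ∈ Set.Icc (0 : ℝ) 1, ∀ t ∈ Set.Icc (0 : ℝ) 1, ∀ τ ∈ Set.Icc (0 : ℝ) 1,
      (1 - τ) * g (mixture A B s) + τ * g (mixture A B t) ≤
        g (mixture (mixture A B s) (mixture A B t) τ)) :
    ConcaveOn ℝ (Set.Icc 0 1) fun τ => g (mixture A B τ) := by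
  refine ⟨convex_Icc 0 1, fun s hs t ht a b ha hb hab => ?_⟩
  obtain rfl : a = 1 - b := by linarith
  have := h s hs t ht b ⟨hb, by linarith⟩
  rwa [mixture_mixture] at this

theorem convexOn_mixture {g : Matrix (Fin n) (Fin n) ℂ → ℝ}
    (h : ∀ s ∈ Set.Icc (0 : ℝ) 1, ∀ t ∈ Set.Icc (0 : ℝ) 1, ∀ τ ∈ Set.Icc (0 : ℝ) 1,
      g (mixture (mixture A B s) (mixture A B t) τ) ≤
        (1 - τ) * g (mixture A B s) + τ * g (mixture A B t)) :
    ConvexOn ℝ (Set.Icc 0 1) fun τ => g (mixture A B τ) := by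
  rw [← neg_concaveOn_iff]
  exact concaveOn_mixture (g := fun M => -g M) fun s hs t ht τ hτ => by linarith [h s hs t ht τ hτ]

theorem traceFun_pos (hn : 0 < n) (hF : ∀ x ∈ J, 0 < F x) (hA : A.IsHermitian)
    (hAJ : spectrum ℝ A ⊆ J) : 0 < traceFun F A := by
  rw [traceFun_eq_sum F hA]
  exact Finset.sum_pos (fun i _ => hF _ (hAJ (hA.eigenvalues_mem_spectrum_real i)))
    ⟨⟨0, hn⟩, Finset.mem_univ _⟩

/-- Pointwise log-convexity on the diagonal entries in an eigenbasis of the mixture, then Hölder,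
then Peierls for `A` and `B`. Peierls needs convexity of `F`, which follows from log-convexity by
AM-GM. -/
theorem traceFun_mixture_le_rpow_mul_rpow (hn : 0 < n) (hJ : J.OrdConnected)
    (hF : LogConvexOn J F) (hA : A.IsHermitian) (hB : B.IsHermitian) (hAJ : spectrum ℝ A ⊆ J)
    (hBJ : spectrum ℝ B ⊆ J) {τ : ℝ} (hτ : τ ∈ Set.Icc (0 : ℝ) 1) :
    traceFun F (mixture A B τ) ≤ traceFun F A ^ (1 - τ) * traceFun F B ^ τ := by
  have : Nonempty (Fin n) := ⟨⟨0, hn⟩⟩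
  obtain ⟨hpos, hlog⟩ := hF
  have hpt : ∀ x ∈ J, ∀ y ∈ J, ∀ t ∈ Set.Icc (0 : ℝ) 1,
      F ((1 - t) * x + t * y) ≤ F x ^ (1 - t) * F y ^ t := fun x hx y hy t ht => by
    have h1 : 0 ≤ 1 - t := sub_nonneg.mpr ht.2
    have hm : (1 - t) * x + t * y ∈ J := hJ.convex hx hy h1 ht.1 (sub_add_cancel 1 t)
    have h := hlog.2 hx hy h1 ht.1 (sub_add_cancel 1 t)
    simp only [smul_eq_mul] at h
    rwa [← Real.log_le_log_iff (hpos _ hm) (mul_pos (Real.rpow_pos_of_pos (hpos x hx) _)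
      (Real.rpow_pos_of_pos (hpos y hy) _)), Real.log_mul (Real.rpow_pos_of_pos (hpos x hx) _).ne'
      (Real.rpow_pos_of_pos (hpos y hy) _).ne', Real.log_rpow (hpos x hx),
      Real.log_rpow (hpos y hy)]
  have hconv : ConvexOn ℝ J F := by
    refine ⟨hJ.convex, fun x hx y hy a b ha hb hab => ?_⟩
    obtain rfl : a = 1 - b := by linarith
    have hb' : b ∈ Set.Icc (0 : ℝ) 1 := ⟨hb, by linarith⟩
    exact (hpt x hx y hy b hb').trans
      (geom_mean_le_weighted_add hb' (hpos x hx).le (hpos y hy).le)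
  obtain ⟨U, hU, h⟩ := exists_eigenvalues_mixture hA hB τ
  have hmA := hA.re_diag_mem hJ.convex hAJ hU
  have hmB := hB.re_diag_mem hJ.convex hBJ hU
  rw [traceFun_eq_sum F (isHermitian_mixture hA hB τ)]
  simp only [h]
  have h1 : 0 ≤ 1 - τ := sub_nonneg.mpr hτ.2
  have h0 := hτ.1
  have hSA : 0 ≤ ∑ i, F ((star U * A * U) i i).re :=
    Finset.sum_nonneg fun i _ => (hpos _ (hmA i)).le
  have hSB : 0 ≤ ∑ i, F ((star U * B * U) i i).re :=
    Finset.sum_nonneg fun i _ => (hpos _ (hmB i)).le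
  have hPA := hA.sum_convex_diag_le hconv hAJ hU
  have hPB := hB.sum_convex_diag_le hconv hBJ hU
  calc _ ≤ ∑ i, F ((star U * A * U) i i).re ^ (1 - τ) * F ((star U * B * U) i i).re ^ τ :=
        Finset.sum_le_sum fun i _ => hpt _ (hmA i) _ (hmB i) τ hτ
    _ ≤ (∑ i, F ((star U * A * U) i i).re) ^ (1 - τ) * (∑ i, F ((star U * B * U) i i).re) ^ τ :=
        sum_rpow_mul_rpow_le hτ (fun i => hpos _ (hmA i)) fun i => hpos _ (hmB i)
    _ ≤ traceFun F A ^ (1 - τ) * traceFun F B ^ τ :=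
        mul_le_mul (Real.rpow_le_rpow hSA hPA h1) (Real.rpow_le_rpow hSB hPB h0)
          (Real.rpow_nonneg hSB _) (Real.rpow_nonneg (hSA.trans hPA) _)

theorem Matrix.IsHermitian.traceFun_const_mul (hA : A.IsHermitian) (σ : ℝ) (F : ℝ → ℝ) :
    traceFun (fun x => σ * F x) A = σ * traceFun F A := by
  rw [traceFun_eq_sum _ hA, traceFun_eq_sum _ hA, Finset.mul_sum]

/-- Power mean inequalities pass from `F` to `Tr F`, in either direction according to the
sign `σ`. -/
theorem mul_traceFun_mixture_le (hn : 0 < n) {σ r : ℝ} (hσ : σ = 1 ∨ σ = -1) (hr : r ≠ 0)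
    (hc : ConvexOn ℝ (Set.Ioi 0) fun x : ℝ => σ * x ^ r) (hJ : J.OrdConnected)
    (hpos : ∀ x ∈ J, 0 < F x)
    (hF : ∀ x ∈ J, ∀ y ∈ J, ∀ t ∈ Set.Icc (0 : ℝ) 1,
      σ * F ((1 - t) * x + t * y) ≤ σ * powerMean r t (F x) (F y))
    (hA : A.IsHermitian) (hB : B.IsHermitian) (hAJ : spectrum ℝ A ⊆ J)
    (hBJ : spectrum ℝ B ⊆ J) {τ : ℝ} (hτ : τ ∈ Set.Icc (0 : ℝ) 1) :
    σ * traceFun F (mixture A B τ) ≤ σ * powerMean r τ (traceFun F A) (traceFun F B) := by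
  have : Nonempty (Fin n) := ⟨⟨0, hn⟩⟩
  -- Comparing the power mean with the arithmetic mean gives convexity of `σ F`, which Peierls'
  -- inequality requires.
  have hconv : ConvexOn ℝ J fun x => σ * F x := by
    refine ⟨hJ.convex, fun x hx y hy a b ha hb hab => ?_⟩
    obtain rfl : a = 1 - b := by linarith
    have hb' : b ∈ Set.Icc (0 : ℝ) 1 := ⟨hb, by linarith⟩
    exact (hF x hx y hy b hb').trans (mul_powerMean_le hr hc hb' (hpos x hx) (hpos y hy))
  obtain ⟨U, hU, h⟩ := exists_eigenvalues_mixture hA hB τ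
  have hmA := fun i => hpos _ (hA.re_diag_mem hJ.convex hAJ hU i)
  have hmB := fun i => hpos _ (hB.re_diag_mem hJ.convex hBJ hU i)
  have hSA : 0 < ∑ i, F ((star U * A * U) i i).re :=
    Finset.sum_pos (fun i _ => hmA i) Finset.univ_nonempty
  have hSB : 0 < ∑ i, F ((star U * B * U) i i).re :=
    Finset.sum_pos (fun i _ => hmB i) Finset.univ_nonempty
  have hPA := hA.sum_convex_diag_le hconv hAJ hU
  have hPB := hB.sum_convex_diag_le hconv hBJ hU
  rw [← Finset.mul_sum, hA.traceFun_const_mul] at hPA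
  rw [← Finset.mul_sum, hB.traceFun_const_mul] at hPB
  rw [traceFun_eq_sum F (isHermitian_mixture hA hB τ), Finset.mul_sum]
  simp only [h]
  calc _ ≤ ∑ i, σ * powerMean r τ (F ((star U * A * U) i i).re) (F ((star U * B * U) i i).re) :=
        Finset.sum_le_sum fun i _ => hF _ (hA.re_diag_mem hJ.convex hAJ hU i) _
          (hB.re_diag_mem hJ.convex hBJ hU i) τ hτ
    _ ≤ σ * powerMean r τ (∑ i, F ((star U * A * U) i i).re) (∑ i, F ((star U * B * U) i i).re) := by
        rw [← Finset.mul_sum]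
        exact mul_sum_powerMean_le hr hc hτ hmA hmB
    _ ≤ σ * powerMean r τ (traceFun F A) (traceFun F B) := by
        -- Peierls' inequality bounds the diagonal sums above by traces for `σ = 1` and below for `σ
        -- = -1`; in both cases monotonicity of the power mean gives the required direction.
        rcases hσ with rfl | rfl
        · simp only [one_mul] at *
          exact powerMean_mono hτ hSA hSB hPA hPB
        · simp only [neg_one_mul, neg_le_neg_iff] at *
          exact powerMean_mono hτ (traceFun_pos hn hpos hA hAJ) (traceFun_pos hn hpos hB hBJ)
            hPA hPB

theorem traceFun_mixture_rpow_le (hn : 0 < n) {p : ℝ} (hp : 1 ≤ p) (hJ : J.OrdConnected)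
    (hpos : ∀ x ∈ J, 0 < F x) (hF : ConvexOn ℝ J fun x => F x ^ (1 / p))
    (hA : A.IsHermitian) (hB : B.IsHermitian) (hAJ : spectrum ℝ A ⊆ J)
    (hBJ : spectrum ℝ B ⊆ J) {τ : ℝ} (hτ : τ ∈ Set.Icc (0 : ℝ) 1) :
    traceFun F (mixture A B τ) ^ (1 / p) ≤
      (1 - τ) * traceFun F A ^ (1 / p) + τ * traceFun F B ^ (1 / p) := by
  have hp0 : 0 < p := one_pos.trans_le hp
  have hmain := mul_traceFun_mixture_le hn (σ := 1) (r := p) (Or.inl rfl) hp0.ne'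
    (by simpa using (convexOn_rpow hp).subset Set.Ioi_subset_Ici_self (convex_Ioi 0)) hJ hpos
    (fun x hx y hy t ht => by
      have h1 : 0 ≤ 1 - t := sub_nonneg.mpr ht.2
      have hm : 0 < F ((1 - t) * x + t * y) :=
        hpos _ (hJ.convex hx hy h1 ht.1 (sub_add_cancel 1 t))
      have h := hF.2 hx hy h1 ht.1 (sub_add_cancel 1 t)
      simp only [smul_eq_mul] at h
      rw [one_mul, one_mul, ← rpow_one_div_rpow hp0.ne' hm]
      exact Real.rpow_le_rpow (Real.rpow_pos_of_pos hm _).le h hp0.le) hA hB hAJ hBJ hτ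
  rw [one_mul, one_mul] at hmain
  rw [← powerMean_rpow hp0.ne' hτ (traceFun_pos hn hpos hA hAJ) (traceFun_pos hn hpos hB hBJ)]
  exact Real.rpow_le_rpow (traceFun_pos hn hpos (isHermitian_mixture hA hB τ)
    (spectrum_mixture_subset hJ hA hB hAJ hBJ hτ)).le hmain (one_div_pos.mpr hp0).le

theorem le_traceFun_mixture_rpow (hn : 0 < n) {p : ℝ} (hp0 : 0 < p) (hp : p ≤ 1)
    (hJ : J.OrdConnected) (hpos : ∀ x ∈ J, 0 < F x)
    (hF : ConcaveOn ℝ J fun x => F x ^ (1 / p))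
    (hA : A.IsHermitian) (hB : B.IsHermitian) (hAJ : spectrum ℝ A ⊆ J)
    (hBJ : spectrum ℝ B ⊆ J) {τ : ℝ} (hτ : τ ∈ Set.Icc (0 : ℝ) 1) :
    (1 - τ) * traceFun F A ^ (1 / p) + τ * traceFun F B ^ (1 / p) ≤
      traceFun F (mixture A B τ) ^ (1 / p) := by
  have hmain := mul_traceFun_mixture_le hn (σ := -1) (r := p) (Or.inr rfl) hp0.ne'
    (by simpa [Pi.neg_def] using
      ((Real.concaveOn_rpow hp0.le hp).subset Set.Ioi_subset_Ici_self (convex_Ioi 0)).neg) hJ hpos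
    (fun x hx y hy t ht => by
      have h1 : 0 ≤ 1 - t := sub_nonneg.mpr ht.2
      have hm : 0 < F ((1 - t) * x + t * y) :=
        hpos _ (hJ.convex hx hy h1 ht.1 (sub_add_cancel 1 t))
      have h := hF.2 hx hy h1 ht.1 (sub_add_cancel 1 t)
      simp only [smul_eq_mul] at h
      rw [neg_one_mul, neg_one_mul, neg_le_neg_iff, ← rpow_one_div_rpow hp0.ne' hm]
      exact Real.rpow_le_rpow (weighted_add_pos ht (Real.rpow_pos_of_pos (hpos x hx) _)
        (Real.rpow_pos_of_pos (hpos y hy) _)).le h hp0.le) hA hB hAJ hBJ hτ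
  rw [neg_one_mul, neg_one_mul, neg_le_neg_iff] at hmain
  have hTA := traceFun_pos hn hpos hA hAJ
  have hTB := traceFun_pos hn hpos hB hBJ
  rw [← powerMean_rpow hp0.ne' hτ hTA hTB]
  exact Real.rpow_le_rpow (powerMean_pos hτ hTA hTB).le hmain (one_div_pos.mpr hp0).le

/-- The power mean argument with `r = -p` and `σ = 1`: `x ^ (-p)` is convex, and the negative powers
reverse the order both when the hypothesis is turned into an upper bound for `F` and when the
conclusion is read off. -/
theorem le_traceFun_mixture_rpow_neg (hn : 0 < n) {p : ℝ} (hp0 : 0 < p)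
    (hJ : J.OrdConnected) (hpos : ∀ x ∈ J, 0 < F x)
    (hF : ConcaveOn ℝ J fun x => F x ^ (-1 / p))
    (hA : A.IsHermitian) (hB : B.IsHermitian) (hAJ : spectrum ℝ A ⊆ J)
    (hBJ : spectrum ℝ B ⊆ J) {τ : ℝ} (hτ : τ ∈ Set.Icc (0 : ℝ) 1) :
    (1 - τ) * traceFun F A ^ (-1 / p) + τ * traceFun F B ^ (-1 / p) ≤
      traceFun F (mixture A B τ) ^ (-1 / p) := by
  have e : -1 / p = 1 / (-p) := by rw [neg_div, div_neg]
  rw [e] at hF ⊢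
  have hr : -p < 0 := neg_neg_of_pos hp0
  have hmain := mul_traceFun_mixture_le hn (σ := 1) (r := -p) (Or.inl rfl) hr.ne
    (by simpa using convexOn_rpow_of_nonpos hr.le) hJ hpos
    (fun x hx y hy t ht => by
      have h1 : 0 ≤ 1 - t := sub_nonneg.mpr ht.2
      have hm : 0 < F ((1 - t) * x + t * y) :=
        hpos _ (hJ.convex hx hy h1 ht.1 (sub_add_cancel 1 t))
      have h := hF.2 hx hy h1 ht.1 (sub_add_cancel 1 t)
      simp only [smul_eq_mul] at h
      rw [one_mul, one_mul, ← rpow_one_div_rpow hr.ne hm]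
      exact Real.rpow_le_rpow_of_nonpos (weighted_add_pos ht (Real.rpow_pos_of_pos (hpos x hx) _)
        (Real.rpow_pos_of_pos (hpos y hy) _)) h hr.le) hA hB hAJ hBJ hτ
  rw [one_mul, one_mul] at hmain
  rw [← powerMean_rpow hr.ne hτ (traceFun_pos hn hpos hA hAJ) (traceFun_pos hn hpos hB hBJ)]
  exact Real.rpow_le_rpow_of_nonpos (traceFun_pos hn hpos (isHermitian_mixture hA hB τ)
    (spectrum_mixture_subset hJ hA hB hAJ hBJ hτ)) hmain (one_div_neg.mpr hr).le

theorem isAffineHermitianFamily_mixture (hA : A.IsHermitian) (hB : B.IsHermitian) :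
    IsAffineHermitianFamily (mixture A B) (Set.Icc 0 1) := by
  have hu : UniqueDiffOn ℝ (Set.Icc (0 : ℝ) 1) := uniqueDiffOn_Icc one_pos
  refine ⟨fun τ _ => isHermitian_mixture hA hB τ, fun i j => ?_, fun i j τ hτ => ?_⟩
  · simp only [mixture_apply]
    exact (analyticOn_const).add (analyticOn_id.smul analyticOn_const)
  · have hd : ∀ t ∈ Set.Icc (0 : ℝ) 1,
        derivWithin (fun s => mixture A B s i j) (Set.Icc 0 1) t = B i j - A i j := fun t ht => by
      simp only [mixture_apply]
      have h := ((hasDerivAt_id t).smul_const (B i j - A i j)).const_add (A i j)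
      simpa using h.hasDerivWithinAt.derivWithin (hu t ht)
    rw [derivWithin_congr hd (hd τ hτ)]
    exact congrFun (derivWithin_const _ _) τ

/-- `exp (-φ / c)` is concave if `φ'² ≤ c φ''`. -/
theorem concaveOn_exp_neg_div {φ : ℝ → ℝ} {T : Set ℝ} (hT : Convex ℝ T) {c : ℝ} (hc : 0 < c)
    (hφ : TwiceDifferentiableOn φ T)
    (h : ∀ t ∈ T, firstDeriv φ T t ^ 2 ≤ c * secondDeriv φ T t) :
    ConcaveOn ℝ T fun t => Real.exp (-(φ t / c)) := by
  have h1 : ∀ t ∈ T, HasDerivWithinAt (fun t => Real.exp (-(φ t / c)))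
      (Real.exp (-(φ t / c)) * -(firstDeriv φ T t / c)) T t := fun t ht =>
    ((hφ.1 t ht).hasDerivWithinAt.div_const c).fun_neg.exp
  refine concaveOn_of_hasDerivWithinAt2_nonpos hT (fun t ht => (h1 t ht).continuousWithinAt)
    (fun t ht => (h1 t (interior_subset ht)).mono interior_subset)
    (fun t ht => ((h1 t (interior_subset ht)).mul
      ((hφ.2 t (interior_subset ht)).hasDerivWithinAt.div_const c).fun_neg).mono interior_subset)
    fun t ht => ?_
  have hi := h t (interior_subset ht)
  have e : Real.exp (-(φ t / c)) * -(firstDeriv φ T t / c) * -(firstDeriv φ T t / c) +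
      Real.exp (-(φ t / c)) * -(secondDeriv φ T t / c) =
      Real.exp (-(φ t / c)) / c ^ 2 * (firstDeriv φ T t ^ 2 - c * secondDeriv φ T t) := by
    field_simp
    ring
  refine le_of_eq_of_le e (mul_nonpos_of_nonneg_of_nonpos (by positivity) (by linarith))

/-- Summing `G ≤ a` over the `n` eigenvalues gives `Tr G ≤ a n`, so `φ = Tr F` satisfies `φ'² ≤ a n
φ''`. -/
theorem concaveOn_exp_neg_traceFun_mixture (hn : 0 < n) (hJ : J.OrdConnected)
    (hA : A.IsHermitian) (hB : B.IsHermitian) (hAJ : spectrum ℝ A ⊆ J)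
    (hBJ : spectrum ℝ B ⊆ J) {a : ℝ} (ha : 0 < a) (hF : TwiceDifferentiableOn F J)
    (h2 : ∀ x ∈ J, 0 < secondDeriv F J x) (hG : ∀ x ∈ J, quotG F J x ≤ a) :
    ConcaveOn ℝ (Set.Icc 0 1) fun τ => Real.exp (-(traceFun F (mixture A B τ) / (a * n))) := by
  have hT : (Set.Icc (0 : ℝ) 1).OrdConnected := Set.ordConnected_Icc
  have hT' : (Set.Icc (0 : ℝ) 1).Nontrivial := ⟨0, by simp, 1, by simp, zero_ne_one⟩
  have hH := isAffineHermitianFamily_mixture hA hB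
  have hs := fun τ (hτ : τ ∈ Set.Icc (0 : ℝ) 1) => spectrum_mixture_subset hJ hA hB hAJ hBJ hτ
  have hn' : (0 : ℝ) < n := by exact_mod_cast hn
  refine concaveOn_exp_neg_div (convex_Icc 0 1) (mul_pos ha hn')
    (twiceDifferentiableOn_traceFun hT hT' hH hs hF) fun τ hτ => ?_
  obtain ⟨h0, h⟩ := traceFun_secondDeriv_inequality hT hT' hJ hH hs hF h2 hτ
  refine h.trans (mul_le_mul_of_nonneg_right ?_ h0)
  have hM := isHermitian_mixture hA hB τ
  rw [traceFun_eq_sum _ hM]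
  refine (Finset.sum_le_sum fun i _ =>
    hG _ (hs τ hτ (hM.eigenvalues_mem_spectrum_real i))).trans_eq ?_
  rw [Finset.sum_const, Finset.card_univ, Fintype.card_fin, nsmul_eq_mul, mul_comm]

end Mixture

/-! ### Hadamard's and Minkowski's determinant inequalities. -/

section Determinant

variable {n : ℕ} {A B : Matrix (Fin n) (Fin n) ℂ}

theorem Matrix.IsHermitian.re_det_eq_prod_eigenvalues (hA : A.IsHermitian) :
    A.det.re = ∏ i, hA.eigenvalues i := by
  rw [hA.det_eq_prod_eigenvalues]
  exact_mod_cast Complex.ofReal_re (∏ i, hA.eigenvalues i)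

theorem Matrix.PosSemidef.spectrum_subset_Ici (hA : A.PosSemidef) :
    spectrum ℝ A ⊆ Set.Ici 0 := by
  rw [hA.1.spectrum_real_eq_range_eigenvalues]
  rintro _ ⟨i, rfl⟩
  exact hA.eigenvalues_nonneg i

/-- **Hadamard's inequality**, in an arbitrary orthonormal basis. -/
theorem Matrix.PosSemidef.re_det_le_prod_diag (hA : A.PosSemidef)
    {U : Matrix (Fin n) (Fin n) ℂ} (hU : U ∈ unitaryGroup (Fin n) ℂ) :
    A.det.re ≤ ∏ i, ((star U * A * U) i i).re := by
  have hnn := hA.1.re_diag_mem (convex_Ici 0) hA.spectrum_subset_Ici hU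
  rw [hA.1.re_det_eq_prod_eigenvalues]
  -- Logarithms require positive eigenvalues; in the singular case the determinant is zero and the
  -- diagonal is nonnegative.
  by_cases hz : ∃ i, hA.1.eigenvalues i = 0
  · obtain ⟨i, hi⟩ := hz
    rw [Finset.prod_eq_zero (Finset.mem_univ i) hi]
    exact Finset.prod_nonneg fun i _ => hnn i
  · push Not at hz
    have hpos : ∀ i, 0 < hA.1.eigenvalues i := fun i => (hA.eigenvalues_nonneg i).lt_of_ne' (hz i)
    have hs : spectrum ℝ A ⊆ Set.Ioi 0 := by
      rw [hA.1.spectrum_real_eq_range_eigenvalues]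
      rintro _ ⟨i, rfl⟩
      exact hpos i
    have hd : ∀ i, 0 < ((star U * A * U) i i).re := hA.1.re_diag_mem (convex_Ioi 0) hs hU
    -- Hadamard's inequality is the concave Peierls inequality for `log`, exponentiated.
    have h := hA.1.le_sum_concave_diag strictConcaveOn_log_Ioi.concaveOn hs hU
    rw [traceFun_eq_sum _ hA.1, ← Real.log_prod fun i _ => (hpos i).ne',
      ← Real.log_prod fun i _ => (hd i).ne', Real.log_le_log_iff
        (Finset.prod_pos fun i _ => hpos i) (Finset.prod_pos fun i _ => hd i)] at h
    exact h

theorem Matrix.PosSemidef.re_det_nonneg (hA : A.PosSemidef) : 0 ≤ A.det.re := by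
  rw [hA.1.re_det_eq_prod_eigenvalues]
  exact Finset.prod_nonneg fun i _ => hA.eigenvalues_nonneg i

theorem mul_rpow_le_prod_rpow (hn : (n : ℝ) ≠ 0) {c d : ℝ} (hc : 0 ≤ c) {x : Fin n → ℝ}
    (hx : ∀ i, 0 ≤ x i) (hd : 0 ≤ d) (hdx : d ≤ ∏ i, x i) :
    c * d ^ (1 / (n : ℝ)) ≤ (∏ i, c * x i) ^ (1 / (n : ℝ)) := by
  rw [Finset.prod_mul_distrib, Finset.prod_const, Finset.card_univ, Fintype.card_fin,
    Real.mul_rpow (pow_nonneg hc n) (Finset.prod_nonneg fun i _ => hx i), ← Real.rpow_natCast,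
    ← Real.rpow_mul hc, mul_one_div_cancel hn, Real.rpow_one]
  exact mul_le_mul_of_nonneg_left (Real.rpow_le_rpow hd hdx (by positivity)) hc

/-- **Minkowski's determinant inequality**. -/
theorem le_re_det_mixture_rpow (hn : 0 < n) (hA : A.PosSemidef) (hB : B.PosSemidef) {τ : ℝ}
    (hτ : τ ∈ Set.Icc (0 : ℝ) 1) :
    (1 - τ) * A.det.re ^ (1 / (n : ℝ)) + τ * B.det.re ^ (1 / (n : ℝ)) ≤
      (mixture A B τ).det.re ^ (1 / (n : ℝ)) := by
  have : Nonempty (Fin n) := ⟨⟨0, hn⟩⟩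
  have hn' : (n : ℝ) ≠ 0 := by exact_mod_cast hn.ne'
  have h1 : 0 ≤ 1 - τ := sub_nonneg.mpr hτ.2
  obtain ⟨U, hU, h⟩ := exists_eigenvalues_mixture hA.1 hB.1 τ
  have hmA : ∀ i, 0 ≤ ((star U * A * U) i i).re :=
    hA.1.re_diag_mem (convex_Ici 0) hA.spectrum_subset_Ici hU
  have hmB : ∀ i, 0 ≤ ((star U * B * U) i i).re :=
    hB.1.re_diag_mem (convex_Ici 0) hB.spectrum_subset_Ici hU
  rw [(isHermitian_mixture hA.1 hB.1 τ).re_det_eq_prod_eigenvalues]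
  simp only [h]
  -- The eigenvalues of the mixture are sums of the diagonal entries of `(1 - τ) A` and `τ B` in its
  -- eigenbasis. Superadditivity splits their geometric mean, and Hadamard's inequality bounds each
  -- part below by a determinant.
  have hsup := geom_mean_add_le (fun i => mul_nonneg h1 (hmA i)) fun i => mul_nonneg hτ.1 (hmB i)
  rw [Fintype.card_fin] at hsup
  refine le_trans (add_le_add ?_ ?_) hsup
  · exact mul_rpow_le_prod_rpow hn' h1 hmA hA.re_det_nonneg (hA.re_det_le_prod_diag hU)
  · exact mul_rpow_le_prod_rpow hn' hτ.1 hmB hB.re_det_nonneg (hB.re_det_le_prod_diag hU)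

end Determinant

end

theorem mainTheorem8 (n : ℕ) (hn : 0 < n) :
    -- the differential inequality, for analytic Hermitian families with vanishing second derivative
    (∀ (T J : Set ℝ) (H : ℝ → Matrix (Fin n) (Fin n) ℂ) (F : ℝ → ℝ),
      T.OrdConnected → T.Nontrivial → J.OrdConnected →
      IsAffineHermitianFamily H T →
      (∀ τ ∈ T, spectrum ℝ (H τ) ⊆ J) →
      TwiceDifferentiableOn F J →
      ((∀ x ∈ J, 0 < secondDeriv F J x) ∨ (∀ x ∈ J, secondDeriv F J x < 0)) →
      TwiceDifferentiableOn (fun τ => traceFun F (H τ)) T ∧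
      ∀ τ ∈ T,
        traceFun (quotG F J) (H τ) * secondDeriv (fun s => traceFun F (H s)) T τ
          ≥ (firstDeriv (fun s => traceFun F (H s)) T τ) ^ 2) ∧
    -- the consequences for `(1 - τ) A + τ B` with `A`, `B` positive
    (∀ (A B : Matrix (Fin n) (Fin n) ℂ), A.PosSemidef → B.PosSemidef →
      (∀ (J : Set ℝ) (F : ℝ → ℝ), J.OrdConnected → spectrum ℝ A ⊆ J → spectrum ℝ B ⊆ J →
        -- (1)
        (LogConvexOn J F →
          LogConvexOn (Set.Icc 0 1) (fun τ => traceFun F (mixture A B τ)) ∧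
          ∀ τ ∈ Set.Icc (0 : ℝ) 1,
            traceFun F (mixture A B τ) ≤ traceFun F A ^ (1 - τ) * traceFun F B ^ τ) ∧
        -- (2)
        (∀ p : ℝ, 1 ≤ p → (∀ x ∈ J, 0 < F x) → ConvexOn ℝ J (fun x => F x ^ (1 / p)) →
          ConvexOn ℝ (Set.Icc 0 1) (fun τ => traceFun F (mixture A B τ) ^ (1 / p)) ∧
          ∀ τ ∈ Set.Icc (0 : ℝ) 1,
            traceFun F (mixture A B τ) ^ (1 / p)
              ≤ (1 - τ) * traceFun F A ^ (1 / p) + τ * traceFun F B ^ (1 / p)) ∧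
        -- (3)
        (∀ p : ℝ, 0 < p → p ≤ 1 → (∀ x ∈ J, 0 < F x) →
          ConcaveOn ℝ J (fun x => F x ^ (1 / p)) →
          ConcaveOn ℝ (Set.Icc 0 1) (fun τ => traceFun F (mixture A B τ) ^ (1 / p)) ∧
          ∀ τ ∈ Set.Icc (0 : ℝ) 1,
            traceFun F (mixture A B τ) ^ (1 / p)
              ≥ (1 - τ) * traceFun F A ^ (1 / p) + τ * traceFun F B ^ (1 / p)) ∧
        -- (4)
        (∀ p : ℝ, 0 < p → (∀ x ∈ J, 0 < F x) →
          ConcaveOn ℝ J (fun x => F x ^ (-1 / p)) →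
          ConcaveOn ℝ (Set.Icc 0 1) (fun τ => traceFun F (mixture A B τ) ^ (-1 / p)) ∧
          ∀ τ ∈ Set.Icc (0 : ℝ) 1,
            traceFun F (mixture A B τ) ^ (-1 / p)
              ≥ (1 - τ) * traceFun F A ^ (-1 / p) + τ * traceFun F B ^ (-1 / p)) ∧
        -- (5)
        (∀ a : ℝ, 0 < a → TwiceDifferentiableOn F J → (∀ x ∈ J, 0 < secondDeriv F J x) →
          (∀ x ∈ J, quotG F J x ≤ a) →
          ConcaveOn ℝ (Set.Icc 0 1)
            (fun τ => Real.exp (-(traceFun F (mixture A B τ) / (a * n)))))) ∧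
      -- the determinant
      ConcaveOn ℝ (Set.Icc 0 1) (fun τ => (mixture A B τ).det.re ^ (1 / (n : ℝ))) ∧
      ∀ τ ∈ Set.Icc (0 : ℝ) 1,
        (mixture A B τ).det.re ^ (1 / (n : ℝ))
          ≥ (1 - τ) * A.det.re ^ (1 / (n : ℝ)) + τ * B.det.re ^ (1 / (n : ℝ))) := by
  refine ⟨fun T J H F hT hT' hJ hH hs hF h2 =>
    ⟨twiceDifferentiableOn_traceFun hT hT' hH hs hF, fun τ hτ =>
      sq_firstDeriv_traceFun_le hT hT' hJ hH hs hF h2 hτ⟩, fun A B hA hB =>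
    ⟨fun J F hJ hAJ hBJ => ?_, concaveOn_mixture (g := fun M => M.det.re ^ (1 / (n : ℝ)))
      fun s hs t ht τ hτ => le_re_det_mixture_rpow hn (posSemidef_mixture hA hB hs)
        (posSemidef_mixture hA hB ht) hτ, fun τ hτ => le_re_det_mixture_rpow hn hA hB hτ⟩⟩
  have hM := isHermitian_mixture hA.1 hB.1
  have hS := fun τ (hτ : τ ∈ Set.Icc (0 : ℝ) 1) =>
    spectrum_mixture_subset hJ hA.1 hB.1 hAJ hBJ hτ
  refine ⟨fun hF => ⟨⟨fun τ hτ => traceFun_pos hn hF.1 (hM τ) (hS τ hτ), ?_⟩, fun τ hτ =>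
      traceFun_mixture_le_rpow_mul_rpow hn hJ hF hA.1 hB.1 hAJ hBJ hτ⟩,
    fun p hp hpos hF => ⟨?_, fun τ hτ =>
      traceFun_mixture_rpow_le hn hp hJ hpos hF hA.1 hB.1 hAJ hBJ hτ⟩,
    fun p hp0 hp hpos hF => ⟨?_, fun τ hτ =>
      le_traceFun_mixture_rpow hn hp0 hp hJ hpos hF hA.1 hB.1 hAJ hBJ hτ⟩,
    fun p hp0 hpos hF => ⟨?_, fun τ hτ =>
      le_traceFun_mixture_rpow_neg hn hp0 hJ hpos hF hA.1 hB.1 hAJ hBJ hτ⟩,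
    fun a ha hF h2 hG =>
      concaveOn_exp_neg_traceFun_mixture hn hJ hA.1 hB.1 hAJ hBJ ha hF h2 hG⟩
  · refine convexOn_mixture (g := fun M => Real.log (traceFun F M)) fun s hs t ht τ hτ => ?_
    have h := traceFun_mixture_le_rpow_mul_rpow hn hJ hF (hM s) (hM t) (hS s hs) (hS t ht) hτ
    have hps := traceFun_pos hn hF.1 (hM s) (hS s hs)
    have hpt := traceFun_pos hn hF.1 (hM t) (hS t ht)
    have hlog := Real.log_le_log (traceFun_pos hn hF.1 (isHermitian_mixture (hM s) (hM t) τ)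
      (spectrum_mixture_subset hJ (hM s) (hM t) (hS s hs) (hS t ht) hτ)) h
    rwa [Real.log_mul (Real.rpow_pos_of_pos hps _).ne' (Real.rpow_pos_of_pos hpt _).ne',
      Real.log_rpow hps, Real.log_rpow hpt] at hlog
  · exact convexOn_mixture (g := fun M => traceFun F M ^ (1 / p)) fun s hs t ht τ hτ =>
      traceFun_mixture_rpow_le hn hp hJ hpos hF (hM s) (hM t) (hS s hs) (hS t ht) hτ
  · exact concaveOn_mixture (g := fun M => traceFun F M ^ (1 / p)) fun s hs t ht τ hτ =>
      le_traceFun_mixture_rpow hn hp0 hp hJ hpos hF (hM s) (hM t) (hS s hs) (hS t ht) hτ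
  · exact concaveOn_mixture (g := fun M => traceFun F M ^ (-1 / p)) fun s hs t ht τ hτ =>
      le_traceFun_mixture_rpow_neg hn hp0 hJ hpos hF (hM s) (hM t) (hS s hs) (hS t ht) hτ
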